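/- Work over the complex numbers. Let $\mathbb{P}^4$ be the projective space of binary quartics in $t_0,t_1$, with coordinates $(a_0:\dots:a_4)$ for $f=\sum_{i=0}^4\binom4i a_i t_0^{4-i}t_1^i$, and let $\mathbb{P}^6$ be the projective space of binary sextics, with the coefficients as coordinates. Let $Gr(1,4)$ be the Grassmannian of lines in $\mathbb{P}^4$, i.e. of pencils (two-dimensional linear spaces) of binary quartics; it is a projective variety through the Plücker embedding $p\colon Gr(1,4)\hookrightarrow\mathbb{P}^9$, $\langle f,g\rangle\mapsto(a_ib_j-a_jb_i)_{0\le i<j\le 4}$, where $a_i$ and $b_i$ are the coordinates of $f$ and $g$; the closed points of $Gr(1,4)$ are exactly the pencils. Sending a pencil $\langle f_1,f_2\rangle$ to its Jacobian sextic $\det(\partial f_i/\partial t_j)$ gives a unique well-defined morphism of complex varieties $$\mathrm{Jac}\colon Gr(1,4)\longrightarrow\mathbb{P}^6,$$ and this morphism is a finite ramified covering of degree $5$: it is finite and surjective, it is not unramified, the extension of function fields $\mathbb{C}(Gr(1,4))/\mathbb{C}(\mathbb{P}^6)$ has degree $5$, and there is a nonempty Zariski open subset of $\mathbb{P}^6$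 such that the fibre over each of its closed points consists of exactly $5$ points. Moreover, there is a surjective linear map $q\colon\mathbb{C}^{10}\to\mathbb{C}^7$ such that the centre $\{q=0\}\subset\mathbb{P}^9$ of the induced linear projection $\mathbb{P}^9\dashrightarrow\mathbb{P}^6$ does not meet $p(Gr(1,4))$ and $\mathrm{Jac}$ is $p$ followed by this projection. The Plücker variety $p(Gr(1,4))\subset\mathbb{P}^9$ has dimension $6$ and degree $5$ (in terms of its Hilbert polynomial), which is also the degree of $\mathrm{Jac}$. -/

import Mathlib

open CategoryTheory AlgebraicGeometry
open scoped Nat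

attribute [local instance] MvPolynomial.gradedAlgebra

namespace JacobianPencil

noncomputable section

/-! ### Complex projective space, its structure morphism and its closed points -/

/-- The complex projective space with homogeneous coordinates indexed by `σ`, as a scheme. -/
abbrev ProjSpace (σ : Type) : Scheme.{0} := Proj (MvPolynomial.homogeneousSubmodule σ ℂ)

/-- The structure morphism of projective space over `ℂ`. -/
def projSpaceOver (σ : Type) : ProjSpace σ ⟶ Spec (CommRingCat.of ℂ) :=
  Proj.toSpecZero (MvPolynomial.homogeneousSubmodule σ ℂ) ≫
    Spec.map (CommRingCat.ofHom (algebraMap ℂ (MvPolynomial.homogeneousSubmodule σ ℂ 0)))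

/-- Restriction of a polynomial to the line through `v`: the substitution `x_i ↦ v_i T`. -/
def restrictToLine {σ : Type} (v : σ → ℂ) : MvPolynomial σ ℂ →ₐ[ℂ] Polynomial ℂ :=
  MvPolynomial.aeval fun i => Polynomial.C (v i) * Polynomial.X

theorem restrictToLine_of_isHomogeneous {σ : Type} (v : σ → ℂ) {F : MvPolynomial σ ℂ} {d : ℕ}
    (hF : F.IsHomogeneous d) :
    restrictToLine v F = Polynomial.C (MvPolynomial.eval v F) * Polynomial.X ^ d := by
  rw [restrictToLine, MvPolynomial.aeval_def, MvPolynomial.eval₂_eq, MvPolynomial.eval_eq,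
    map_sum, Finset.sum_mul]
  refine Finset.sum_congr rfl fun m hm => ?_
  have hd : ∑ i ∈ m.support, m i = d := by
    have h := hF (MvPolynomial.mem_support_iff.mp hm)
    rw [Finsupp.weight_apply] at h
    simpa [Finsupp.sum] using h
  simp only [mul_pow, Finset.prod_mul_distrib, Finset.prod_pow_eq_pow_sum, hd, map_mul, map_prod,
    map_pow, Polynomial.algebraMap_eq]
  ring

theorem coeff_restrictToLine {σ : Type} (v : σ → ℂ) (F : MvPolynomial σ ℂ) (d : ℕ) :
    (restrictToLine v F).coeff d =
      MvPolynomial.eval v (MvPolynomial.homogeneousComponent d F) := by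
  conv_lhs => rw [← MvPolynomial.sum_homogeneousComponent F]
  rw [map_sum, Polynomial.finsetSum_coeff]
  have h : ∀ i, (restrictToLine v (MvPolynomial.homogeneousComponent i F)).coeff d =
      if i = d then MvPolynomial.eval v (MvPolynomial.homogeneousComponent i F) else 0 := by
    intro i
    rw [restrictToLine_of_isHomogeneous v (MvPolynomial.homogeneousComponent_isHomogeneous i F),
      Polynomial.coeff_C_mul_X_pow]
    simp only [eq_comm]
  simp only [h, Finset.sum_ite_eq', Finset.mem_range]
  split_ifs with hd
  · rfl
  · rw [MvPolynomial.homogeneousComponent_eq_zero _ _ (by omega), map_zero]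

/-- The closed point `(v_i)_i` of projective space: the homogeneous prime ideal of all
polynomials that vanish on the line spanned by the nonzero vector `v`. -/
def point {σ : Type} (v : σ → ℂ) (hv : v ≠ 0) : ProjSpace σ :=
  show ProjectiveSpectrum (MvPolynomial.homogeneousSubmodule σ ℂ) from
  { asHomogeneousIdeal :=
      ⟨RingHom.ker (restrictToLine v), by
        intro d F hF
        have hdec : ((DirectSum.decompose (MvPolynomial.homogeneousSubmodule σ ℂ) F d :
            MvPolynomial.homogeneousSubmodule σ ℂ d) : MvPolynomial σ ℂ) =
            MvPolynomial.homogeneousComponent d F := MvPolynomial.decomposition.decompose'_apply F d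
        rw [hdec, RingHom.mem_ker,
          restrictToLine_of_isHomogeneous v (MvPolynomial.homogeneousComponent_isHomogeneous d F),
          ← coeff_restrictToLine, RingHom.mem_ker.mp hF]
        simp⟩
    isPrime := RingHom.ker_isPrime _
    not_irrelevant_le := by
      intro hle
      obtain ⟨i, hi⟩ := Function.ne_iff.mp hv
      have hX : (MvPolynomial.X i : MvPolynomial σ ℂ) ∈
          HomogeneousIdeal.irrelevant (MvPolynomial.homogeneousSubmodule σ ℂ) :=
        HomogeneousIdeal.mem_irrelevant_of_mem _ zero_lt_one
          (MvPolynomial.isHomogeneous_X ℂ i)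
      have h0 : restrictToLine v (MvPolynomial.X i) = 0 := hle hX
      rw [restrictToLine, MvPolynomial.aeval_X] at h0
      have h1 := congrArg (fun P => Polynomial.coeff P 1) h0
      simp at h1
      exact hi h1 }

/-! ### Linear projections -/

/-- The `j`-th component of a linear map, as a linear form in the coordinates of the source. -/
def linearForm {σ τ : Type} [Fintype σ] [DecidableEq σ] (q : (σ → ℂ) →ₗ[ℂ] (τ → ℂ)) (j : τ) :
    MvPolynomial σ ℂ :=
  ∑ i, MvPolynomial.C (q (Pi.single i 1) j) * MvPolynomial.X i

/-- The centre of the linear projection given by `q`: the linear subspace `q = 0` of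
projective space. -/
def centre {σ τ : Type} [Fintype σ] [DecidableEq σ] (q : (σ → ℂ) →ₗ[ℂ] (τ → ℂ)) :
    Set (ProjSpace σ) :=
  ProjectiveSpectrum.zeroLocus (MvPolynomial.homogeneousSubmodule σ ℂ)
    (Set.range (linearForm q))

/-- The complement of the centre. -/
def offCentre {σ τ : Type} [Fintype σ] [DecidableEq σ] (q : (σ → ℂ) →ₗ[ℂ] (τ → ℂ)) :
    (ProjSpace σ).Opens :=
  ⟨(centre q)ᶜ, (ProjectiveSpectrum.isClosed_zeroLocus
    (MvPolynomial.homogeneousSubmodule σ ℂ) (Set.range (linearForm q))).isOpen_compl⟩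

/-- `pr` is the linear projection `(v) ↦ (q v)`, a morphism of `ℂ`-schemes defined on the
complement of its centre. -/
def IsLinearProjection {σ τ : Type} [Fintype σ] [DecidableEq σ] (q : (σ → ℂ) →ₗ[ℂ] (τ → ℂ))
    (pr : (offCentre q).toScheme ⟶ ProjSpace τ) : Prop :=
  pr ≫ projSpaceOver τ = (offCentre q).ι ≫ projSpaceOver σ ∧
  ∀ (x : (offCentre q).toScheme) (v : σ → ℂ) (hv : v ≠ 0), (offCentre q).ι x = point v hv →
    ∃ hq : q v ≠ 0, pr x = point (q v) hq

/-! ### Degrees -/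

/-- The Hilbert function `d ↦ dim (ℂ[x]/I(Z))_d` of a subset `Z` of projective space. -/
def hilbertFunction {σ : Type} (Z : Set (ProjSpace σ)) (d : ℕ) : ℕ :=
  Module.finrank ℂ (MvPolynomial.homogeneousSubmodule σ ℂ d ⧸
    Submodule.comap (MvPolynomial.homogeneousSubmodule σ ℂ d).subtype
      ((ProjectiveSpectrum.vanishingIdeal
        (𝒜 := MvPolynomial.homogeneousSubmodule σ ℂ) Z).toIdeal.restrictScalars ℂ))

/-- `Z` has dimension `r` and degree `e` in projective space: its Hilbert polynomial has
degree `r` and leading coefficient `e / r!`. -/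
def HasProjectiveDegree {σ : Type} (Z : Set (ProjSpace σ)) (r e : ℕ) : Prop :=
  ∃ P : Polynomial ℚ, (∀ᶠ d : ℕ in Filter.atTop, (hilbertFunction Z d : ℚ) = P.eval (d : ℚ)) ∧
    P.natDegree = r ∧ P.leadingCoeff * (r ! : ℚ) = (e : ℚ)

/-- `f` is a dominant morphism of integral schemes that has degree `d`, the degree of the
extension of function fields (residue fields at the generic points). -/
def HasMorphismDegree {X Y : Scheme.{0}} (f : X ⟶ Y) (d : ℕ) : Prop :=
  IsIntegral X ∧ IsIntegral Y ∧ IsDominant f ∧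
    ∃ x : X, IsGenericPoint x Set.univ ∧ f.residueDegree x = d

/-! ### Pencils of binary quartics, the Grassmannian and the Jacobian -/

/-- The coefficient of `t₀ ^ (d - k) * t₁ ^ k` in a binary form of degree `d`. -/
def formCoeff (d : ℕ) (F : MvPolynomial (Fin 2) ℂ) (k : Fin (d + 1)) : ℂ :=
  F.coeff (Finsupp.single 0 (d - (k : ℕ)) + Finsupp.single 1 (k : ℕ))

/-- The coordinate `a_i` of a binary quartic `f = ∑ i, (4 choose i) * a_i * t₀ ^ (4 - i) * t₁ ^ i`. -/
def quarticCoord (f : MvPolynomial (Fin 2) ℂ) (i : Fin 5) : ℂ :=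
  formCoeff 4 f i / (Nat.choose 4 i : ℂ)

/-- The index set of the ten Plücker coordinates `p_ij`, `i < j`. -/
abbrev PluckerIndex : Type := {p : Fin 5 × Fin 5 // p.1 < p.2}

/-- The Plücker coordinates `p_ij = a_i b_j - a_j b_i` of a pair of binary quartics. -/
def plucker (f g : MvPolynomial (Fin 2) ℂ) (p : PluckerIndex) : ℂ :=
  quarticCoord f p.1.1 * quarticCoord g p.1.2 - quarticCoord f p.1.2 * quarticCoord g p.1.1

/-- The Jacobian determinant `det (∂ f_i / ∂ t_j)` of two binary forms. -/
def jacobian (f g : MvPolynomial (Fin 2) ℂ) : MvPolynomial (Fin 2) ℂ :=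
  Matrix.det (Matrix.of fun i j : Fin 2 => MvPolynomial.pderiv j (![f, g] i))

/-- A pencil of binary quartics: a line in the `ℙ⁴` of binary quartics, that is, a
two-dimensional space of binary quartics. -/
def Pencil : Type :=
  {W : Submodule ℂ (MvPolynomial (Fin 2) ℂ) //
    W ≤ MvPolynomial.homogeneousSubmodule (Fin 2) ℂ 4 ∧ Module.finrank ℂ W = 2}

/-- The Plücker variety in `ℙ⁹`: the Zariski closure of the set of Plücker points of pencils. -/
def pluckerVariety : TopologicalSpace.Closeds (ProjSpace PluckerIndex) :=
  TopologicalSpace.Closeds.closure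
    {x | ∃ (W : Pencil) (f g : MvPolynomial (Fin 2) ℂ) (h : plucker f g ≠ 0),
      W.1 = Submodule.span ℂ {f, g} ∧ x = point (plucker f g) h}

/-- The Grassmannian `Gr(1,4)` with the structure of a projective variety that it has through
the Plücker embedding: the reduced closed subscheme of `ℙ⁹` on the Plücker variety. -/
def Gr : Scheme.{0} := (Scheme.IdealSheafData.vanishingIdeal pluckerVariety).subscheme

/-- The Plücker embedding. -/
def pluckerEmbedding : Gr ⟶ ProjSpace PluckerIndex :=
  (Scheme.IdealSheafData.vanishingIdeal pluckerVariety).subschemeι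

/-- The point `x` of `Gr(1,4)` represents the pencil spanned by `f` and `g`. -/
def Represents (x : Gr) (f g : MvPolynomial (Fin 2) ℂ) : Prop :=
  ∃ h : plucker f g ≠ 0, pluckerEmbedding x = point (plucker f g) h

/-- `J` is the morphism of `ℂ`-schemes `Gr(1,4) ⟶ ℙ⁶` that sends every pencil of binary
quartics to its Jacobian sextic, `ℙ⁶` being the space of binary sextics with their coefficients
as coordinates. -/
def IsJacobianMap (J : Gr ⟶ ProjSpace (Fin 7)) : Prop :=
  J ≫ projSpaceOver (Fin 7) = pluckerEmbedding ≫ projSpaceOver PluckerIndex ∧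
  ∀ (W : Pencil) (f g : MvPolynomial (Fin 2) ℂ), W.1 = Submodule.span ℂ {f, g} →
    ∀ x : Gr, Represents x f g →
      ∃ h : formCoeff 6 (jacobian f g) ≠ 0, J x = point (formCoeff 6 (jacobian f g)) h

end

end JacobianPencil

open JacobianPencil

namespace JacobianPencil

noncomputable section

/-! ### Closed points of projective space -/

section ProjectivePoints

variable {σ : Type}

/-! Everything rests on one algebraic fact. Let A be the homogeneous coordinate ring of the Plücker
variety, that is, polynomials in the p_ij modulo `pluckerIdeal`, and let B be the polynomial ring in
seven variables, acting on A through the coefficients of the Jacobian sextic, which are linear in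
the p_ij. Then A is a free graded B-module with basis 1, p₁₂, p₁₃, p₂₃, p₁₃², in degrees 0, 1, 1, 1,
2.

Spanning (`isSpanned`, in each degree `exists_sub_mem_pluckerIdeal`): up to constant factors the
sextic coefficients s₀, ..., s₆ are p₀₁, p₀₂, p₂₄, p₃₄ and three forms that express p₀₃, p₀₄, p₁₄
through p₁₂, p₁₃, p₂₃; the five three-term Plücker relations then reduce products of p₁₂, p₁₃, p₂₃.
Independence (`eq_zero_of_sum_mem_pluckerIdeal`): for a general sextic, elimination turns the
Plücker relations into a quintic for p₁₂ with simple roots, and each root determines the other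
coordinates. So exactly five Plücker vectors have the given Jacobian (`ncard_solutions`), and the
five basis functions are linearly independent on them (`eq_zero_of_forall_solutions`).

The statements about degree and centre follow. The Hilbert function is the sum of the binomials (d -
e + 6 choose 6) over the basis degrees e, whence dimension 6 and degree 5. A prime that contains
`pluckerIdeal` and all sextic coefficients contains every p_ij (`X_mem_of_pluckerIdeal_le`), so the
centre misses the Plücker variety and the projection restricts to a morphism `jac`. On the chart s₀
≠ 0 the functions on the Grassmannian are free of rank 5 over those on the space of sextics
(`finrank_chart`), and this rank is the degree of the function fields.

The five vectors also give the five points of a general closed fibre (`ncard_fibre`). The map is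
proper and affine, hence finite; its image is closed and contains a dense open set, hence is
everything. It is ramified because a nonzero tangent vector at ⟨t₀⁴, t₀³t₁⟩ does not change the
Jacobian to first order (`sextic_tangentVector`). It is unique because closed points of the
Grassmannian are pencils and a morphism of varieties is determined by its values on them. -/

theorem mem_point_iff {v : σ → ℂ} {hv : v ≠ 0} {F : MvPolynomial σ ℂ} :
    F ∈ (point v hv).asHomogeneousIdeal ↔ restrictToLine v F = 0 :=
  Iff.rfl

theorem mem_point_iff_of_isHomogeneous {v : σ → ℂ} {hv : v ≠ 0} {F : MvPolynomial σ ℂ} {d : ℕ}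
    (hF : F.IsHomogeneous d) :
    F ∈ (point v hv).asHomogeneousIdeal ↔ MvPolynomial.eval v F = 0 := by
  rw [mem_point_iff, restrictToLine_of_isHomogeneous v hF]
  simp

theorem eval_restrictToLine (v : σ → ℂ) (F : MvPolynomial σ ℂ) (c : ℂ) :
    (restrictToLine v F).eval c = MvPolynomial.eval (c • v) F := by
  have : ((Polynomial.evalRingHom c).comp (restrictToLine v).toRingHom) =
      MvPolynomial.eval (c • v) := by
    refine MvPolynomial.ringHom_ext (fun r => ?_) fun i => ?_
    · simp [restrictToLine]
    · simp only [RingHom.comp_apply, AlgHom.toRingHom_eq_coe, RingHom.coe_coe, restrictToLine,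
        MvPolynomial.aeval_X, Polynomial.coe_evalRingHom, Polynomial.eval_mul, Polynomial.eval_C,
        Polynomial.eval_X, MvPolynomial.eval_X, Pi.smul_apply, smul_eq_mul]
      ring
  exact DFunLike.congr_fun this F

theorem restrictToLine_eq_zero_iff {v : σ → ℂ} {F : MvPolynomial σ ℂ} :
    restrictToLine v F = 0 ↔ ∀ c : ℂ, MvPolynomial.eval (c • v) F = 0 := by
  refine ⟨fun h c => by rw [← eval_restrictToLine, h, Polynomial.eval_zero], fun h => ?_⟩
  exact Polynomial.funext fun c => by rw [eval_restrictToLine, h, Polynomial.eval_zero]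

theorem eval_eq_zero_of_mem_point {v : σ → ℂ} {hv : v ≠ 0} {F : MvPolynomial σ ℂ}
    (hF : F ∈ (point v hv).asHomogeneousIdeal) : MvPolynomial.eval v F = 0 := by
  simpa using restrictToLine_eq_zero_iff.mp (mem_point_iff.mp hF) 1

theorem coe_decompose (F : MvPolynomial σ ℂ) (d : ℕ) :
    ((DirectSum.decompose (MvPolynomial.homogeneousSubmodule σ ℂ) F d :
      MvPolynomial.homogeneousSubmodule σ ℂ d) : MvPolynomial σ ℂ) =
      MvPolynomial.homogeneousComponent d F :=
  MvPolynomial.decomposition.decompose'_apply F d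

theorem homogeneousComponent_mem
    (I : HomogeneousIdeal (MvPolynomial.homogeneousSubmodule σ ℂ)) {F : MvPolynomial σ ℂ}
    (hF : F ∈ I) (d : ℕ) : MvPolynomial.homogeneousComponent d F ∈ I := by
  have := I.isHomogeneous d hF
  rwa [coe_decompose] at this

theorem projSpace_ext {x y : ProjSpace σ}
    (h : ∀ (d : ℕ) (F : MvPolynomial σ ℂ), F.IsHomogeneous d →
      (F ∈ x.asHomogeneousIdeal ↔ F ∈ y.asHomogeneousIdeal)) : x = y := by
  refine ProjectiveSpectrum.ext (HomogeneousIdeal.ext' fun d F hF => h d F ?_)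
  exact hF

/-- It is enough to compare the homogeneous elements of positive degree of two points. -/
theorem projSpace_ext_of_pos {x y : ProjSpace σ}
    (h : ∀ (d : ℕ) (F : MvPolynomial σ ℂ), 0 < d → F.IsHomogeneous d →
      (F ∈ x.asHomogeneousIdeal ↔ F ∈ y.asHomogeneousIdeal)) : x = y := by
  refine projSpace_ext fun d F hF => ?_
  rcases Nat.eq_zero_or_pos d with rfl | hd
  -- In degree zero there are only constants: zero lies in every ideal, a unit in no prime.
  · rw [← MvPolynomial.totalDegree_zero_iff_isHomogeneous,
      MvPolynomial.totalDegree_eq_zero_iff_eq_C] at hF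
    by_cases hc : F.coeff 0 = 0
    · rw [hF, hc, map_zero]
      exact ⟨fun _ => zero_mem _, fun _ => zero_mem _⟩
    · have hu : IsUnit F := by
        rw [hF]
        exact (isUnit_iff_ne_zero.mpr hc).map MvPolynomial.C
      exact ⟨fun h => (x.isPrime.ne_top (Ideal.eq_top_of_isUnit_mem _ h hu)).elim,
        fun h => (y.isPrime.ne_top (Ideal.eq_top_of_isUnit_mem _ h hu)).elim⟩
  · exact h d F hd hF

/-- Every form of positive degree lies in the ideal of the variables, so a prime with all variables
would contain the irrelevant ideal. -/
theorem exists_X_notMem (x : ProjSpace σ) :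
    ∃ i, (MvPolynomial.X i : MvPolynomial σ ℂ) ∉ x.asHomogeneousIdeal := by
  by_contra! H
  refine x.not_irrelevant_le ((HomogeneousIdeal.irrelevant_le _).mpr fun d hd F hF => ?_)
  have hspan : F ∈ Ideal.span (MvPolynomial.X '' (Set.univ : Set σ)) := by
    rw [MvPolynomial.mem_ideal_span_X_image]
    intro m hm
    by_contra! h0
    have hm0 : m = 0 := Finsupp.ext fun i => h0 i trivial
    have := hF (MvPolynomial.mem_support_iff.mp hm)
    rw [hm0, map_zero] at this
    omega
  refine Ideal.span_le.mpr ?_ hspan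
  rintro _ ⟨i, -, rfl⟩
  exact H i

theorem mem_closure_iff_ideal_le {x y : ProjSpace σ} :
    y ∈ closure ({x} : Set (ProjSpace σ)) ↔ x.asHomogeneousIdeal ≤ y.asHomogeneousIdeal :=
  (ProjectiveSpectrum.le_iff_mem_closure (𝒜 := MvPolynomial.homogeneousSubmodule σ ℂ) x y).symm

theorem eval_smul_of_isHomogeneous {F : MvPolynomial σ ℂ} {d : ℕ} (hF : F.IsHomogeneous d) (c : ℂ)
    (v : σ → ℂ) : MvPolynomial.eval (c • v) F = c ^ d * MvPolynomial.eval v F := by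
  rw [← eval_restrictToLine, restrictToLine_of_isHomogeneous v hF, Polynomial.eval_C_mul,
    Polynomial.eval_X_pow, mul_comm]

theorem point_smul (v : σ → ℂ) (hv : v ≠ 0) (c : ℂ) (hc : c • v ≠ 0) :
    point (c • v) hc = point v hv := by
  have hc0 : c ≠ 0 := fun h => hc (by rw [h, zero_smul])
  refine projSpace_ext fun d F hF => ?_
  rw [mem_point_iff_of_isHomogeneous hF, mem_point_iff_of_isHomogeneous hF,
    eval_smul_of_isHomogeneous hF]
  simp [hc0]

/-- The linear forms v_i X_j - v_j X_i vanish on the line through v and force proportionality. -/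
theorem exists_smul_of_point_le {v w : σ → ℂ} {hv : v ≠ 0} {hw : w ≠ 0}
    (h : (point v hv).asHomogeneousIdeal ≤ (point w hw).asHomogeneousIdeal) :
    ∃ c : ℂ, w = c • v := by
  obtain ⟨i, hi⟩ := Function.ne_iff.mp hv
  have hi : v i ≠ 0 := hi
  refine ⟨w i / v i, funext fun j => ?_⟩
  have hmem : MvPolynomial.C (v i) * MvPolynomial.X j - MvPolynomial.C (v j) * MvPolynomial.X i ∈
      (point v hv).asHomogeneousIdeal := by
    rw [mem_point_iff]
    simp only [restrictToLine, map_sub, map_mul, MvPolynomial.aeval_X, MvPolynomial.aeval_C,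
      Polynomial.algebraMap_eq]
    ring
  have := eval_eq_zero_of_mem_point (h hmem)
  simp at this
  simp only [Pi.smul_apply, smul_eq_mul]
  field_simp
  linear_combination this

theorem point_eq_point_iff {v w : σ → ℂ} {hv : v ≠ 0} {hw : w ≠ 0} :
    point v hv = point w hw ↔ ∃ c : ℂ, w = c • v := by
  refine ⟨fun h => exists_smul_of_point_le (hv := hv) (hw := hw) (by rw [h]), ?_⟩
  rintro ⟨c, rfl⟩
  exact (point_smul v hv c hw).symm

/-- A homogeneous polynomial outside the ideal of `x` does not vanish at some closed point that
specializes `x`. -/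
theorem exists_point_of_notMem [Finite σ] (x : ProjSpace σ) {G : MvPolynomial σ ℂ}
    (hG : G ∉ x.asHomogeneousIdeal) :
    ∃ (v : σ → ℂ) (hv : v ≠ 0), x.asHomogeneousIdeal ≤ (point v hv).asHomogeneousIdeal ∧
      MvPolynomial.eval v G ≠ 0 := by
  obtain ⟨i, hi⟩ := exists_X_notMem x
  have hprime : x.asHomogeneousIdeal.toIdeal.IsPrime := x.isPrime
  -- The factor X_i ensures that the zero supplied by the Nullstellensatz is not the origin.
  have hGi : G * MvPolynomial.X i ∉ x.asHomogeneousIdeal.toIdeal :=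
    fun h => (hprime.mem_or_mem h).elim hG hi
  rw [← hprime.isRadical.radical, ← MvPolynomial.vanishingIdeal_zeroLocus_eq_radical (K := ℂ),
    MvPolynomial.mem_vanishingIdeal_iff] at hGi
  push Not at hGi
  obtain ⟨v, hv, hGv⟩ := hGi
  simp only [map_mul, MvPolynomial.aeval_X] at hGv
  have hv0 : v ≠ 0 := by
    rintro rfl
    simp at hGv
  refine ⟨v, hv0, fun F hF => ?_, ?_⟩
  · rw [mem_point_iff]
    ext d
    rw [coeff_restrictToLine, Polynomial.coeff_zero]
    have hd := homogeneousComponent_mem _ hF d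
    simpa using hv _ hd
  · intro h
    apply hGv
    rw [MvPolynomial.aeval_eq_eval, h, zero_mul]

/-- Any specialization of the point has in turn a specialization of the form `point w`, and w is
then proportional to v, so all three coincide. -/
theorem isClosed_point [Finite σ] (v : σ → ℂ) (hv : v ≠ 0) :
    IsClosed ({point v hv} : Set (ProjSpace σ)) := by
  refine isClosed_of_closure_subset fun y hy => ?_
  rw [mem_closure_iff_ideal_le] at hy
  obtain ⟨i, hi⟩ := exists_X_notMem y
  obtain ⟨w, hw, hyw, -⟩ := exists_point_of_notMem y hi
  obtain ⟨c, rfl⟩ := exists_smul_of_point_le (hy.trans hyw)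
  rw [point_smul v hv c hw] at hyw
  exact ProjectiveSpectrum.ext (le_antisymm hyw hy)

theorem exists_eq_point_of_isClosed [Finite σ] {x : ProjSpace σ}
    (hx : IsClosed ({x} : Set (ProjSpace σ))) : ∃ (v : σ → ℂ) (hv : v ≠ 0), x = point v hv := by
  obtain ⟨i, hi⟩ := exists_X_notMem x
  obtain ⟨w, hw, hxw, -⟩ := exists_point_of_notMem x hi
  have := mem_closure_iff_ideal_le.mpr hxw
  rw [hx.closure_eq] at this
  exact ⟨w, hw, this.symm⟩

end ProjectivePoints

/-! ### Morphisms given by linear projections -/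

section LinearProjection

open HomogeneousLocalization

variable {σ τ : Type}

theorem X_mem_homogeneousSubmodule (k : τ) :
    (MvPolynomial.X k : MvPolynomial τ ℂ) ∈ MvPolynomial.homogeneousSubmodule τ ℂ 1 :=
  MvPolynomial.isHomogeneous_X ℂ k

/-- Translates membership in a homogeneous prime into membership of F / f ^ d in a prime of the
chart. The restriction to positive d is the reason for `projSpace_ext_of_pos`. -/
theorem mem_awayι_apply_iff {f : MvPolynomial σ ℂ}
    (hf : f ∈ MvPolynomial.homogeneousSubmodule σ ℂ 1) {d : ℕ} (hd : 0 < d)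
    {F : MvPolynomial σ ℂ} (hF : F ∈ MvPolynomial.homogeneousSubmodule σ ℂ d)
    (z : Spec (.of <| Away (MvPolynomial.homogeneousSubmodule σ ℂ) f)) :
    F ∈ (Proj.awayι _ f hf zero_lt_one z).asHomogeneousIdeal ↔
      Away.mk _ hf d F (by simpa using hF) ∈ z.asIdeal := by
  have h := Proj.awayι_preimage_basicOpen _ hf zero_lt_one hF hd
  have h1 : z ∈ Proj.awayι _ f hf zero_lt_one ⁻¹ᵁ Proj.basicOpen _ F ↔
    z ∈ PrimeSpectrum.basicOpen (Away.isLocalizationElem hf hF) := iff_of_eq (congrArg (z ∈ ·) h)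
  have h2 : Away.isLocalizationElem hf hF = Away.mk _ hf d F (by simpa using hF) := by
    simp [Away.isLocalizationElem]
  rw [h2] at h1
  exact not_iff_not.mp h1

variable [Fintype σ] [DecidableEq σ]

theorem linearForm_isHomogeneous (q : (σ → ℂ) →ₗ[ℂ] (τ → ℂ)) (j : τ) :
    (linearForm q j).IsHomogeneous 1 :=
  MvPolynomial.IsHomogeneous.sum _ _ _ fun i _ => by
    simpa using (MvPolynomial.isHomogeneous_C σ (q (Pi.single i 1) j)).mul
      (MvPolynomial.isHomogeneous_X ℂ i)

theorem eval_linearForm (q : (σ → ℂ) →ₗ[ℂ] (τ → ℂ)) (j : τ) (v : σ → ℂ) :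
    MvPolynomial.eval v (linearForm q j) = q v j := by
  conv_rhs => rw [← Finset.univ_sum_single v]
  simp only [linearForm, map_sum, map_mul, MvPolynomial.eval_C, MvPolynomial.eval_X,
    Finset.sum_apply]
  refine Finset.sum_congr rfl fun i _ => ?_
  have : Pi.single i (v i) = v i • (Pi.single i 1 : σ → ℂ) := by
    rw [← Pi.single_smul, smul_eq_mul, mul_one]
  rw [this, map_smul, Pi.smul_apply, smul_eq_mul, mul_comm]

/-- Substitution of the components of a linear map, as a graded ring homomorphism. -/
def linearPullback (q : (σ → ℂ) →ₗ[ℂ] (τ → ℂ)) :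
    GradedRingHom (MvPolynomial.homogeneousSubmodule τ ℂ)
      (MvPolynomial.homogeneousSubmodule σ ℂ) where
  __ := (MvPolynomial.aeval (linearForm q)).toRingHom
  map_mem {d F} hF := by
    have := MvPolynomial.IsHomogeneous.aeval (R := ℂ) (S := ℂ) hF (linearForm q)
      (linearForm_isHomogeneous q)
    rw [one_mul] at this
    exact this

theorem linearPullback_apply (q : (σ → ℂ) →ₗ[ℂ] (τ → ℂ)) (F : MvPolynomial τ ℂ) :
    linearPullback q F = MvPolynomial.aeval (linearForm q) F :=
  rfl

theorem linearPullback_X (q : (σ → ℂ) →ₗ[ℂ] (τ → ℂ)) (k : τ) :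
    linearPullback q (MvPolynomial.X k) = linearForm q k := by
  rw [linearPullback_apply, MvPolynomial.aeval_X]

theorem linearPullback_C (q : (σ → ℂ) →ₗ[ℂ] (τ → ℂ)) (c : ℂ) :
    linearPullback q (MvPolynomial.C c) = MvPolynomial.C c := by
  rw [linearPullback_apply, MvPolynomial.aeval_C]
  rfl

theorem linearPullback_isHomogeneous (q : (σ → ℂ) →ₗ[ℂ] (τ → ℂ)) {F : MvPolynomial τ ℂ} {d : ℕ}
    (hF : F.IsHomogeneous d) : (linearPullback q F).IsHomogeneous d :=
  (linearPullback q).map_mem hF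

theorem linearPullback_X_mem (q : (σ → ℂ) →ₗ[ℂ] (τ → ℂ)) (k : τ) :
    linearPullback q (MvPolynomial.X k) ∈ MvPolynomial.homogeneousSubmodule σ ℂ 1 :=
  (linearPullback q).map_mem (X_mem_homogeneousSubmodule k)

theorem eval_linearPullback (q : (σ → ℂ) →ₗ[ℂ] (τ → ℂ)) (F : MvPolynomial τ ℂ) (v : σ → ℂ) :
    MvPolynomial.eval v (linearPullback q F) = MvPolynomial.eval (q v) F := by
  have : (MvPolynomial.eval v).comp (linearPullback q).toRingHom = MvPolynomial.eval (q v) := by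
    refine MvPolynomial.ringHom_ext (fun r => ?_) fun i => ?_
    · simp [linearPullback]
    · simp [linearPullback, eval_linearForm]
  exact DFunLike.congr_fun this F

theorem mem_offCentre_iff (q : (σ → ℂ) →ₗ[ℂ] (τ → ℂ)) (x : ProjSpace σ) :
    x ∈ offCentre q ↔ ∃ k, linearForm q k ∉ x.asHomogeneousIdeal := by
  have h : x ∈ offCentre q ↔ ¬ ∀ k, linearForm q k ∈ x.asHomogeneousIdeal :=
    not_congr Set.range_subset_iff
  rw [h, not_forall]

/-- The standard chart of projective space on which the `k`-th component of `q` is invertible. -/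
abbrev sourceChart (q : (σ → ℂ) →ₗ[ℂ] (τ → ℂ)) (k : τ) :
    Spec (.of <| Away (MvPolynomial.homogeneousSubmodule σ ℂ)
      (linearPullback q (MvPolynomial.X k))) ⟶ ProjSpace σ :=
  Proj.awayι _ _ (linearPullback_X_mem q k) zero_lt_one

/-- The standard chart of projective space on which the `k`-th coordinate is invertible. -/
abbrev targetChart (k : τ) :
    Spec (.of <| Away (MvPolynomial.homogeneousSubmodule τ ℂ)
      (MvPolynomial.X k : MvPolynomial τ ℂ)) ⟶ ProjSpace τ :=
  Proj.awayι _ _ (X_mem_homogeneousSubmodule k) zero_lt_one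

/-- The linear projection in coordinates. -/
abbrev chartMap (q : (σ → ℂ) →ₗ[ℂ] (τ → ℂ)) (k : τ) :
    Spec (.of <| Away (MvPolynomial.homogeneousSubmodule σ ℂ)
      (linearPullback q (MvPolynomial.X k))) ⟶
    Spec (.of <| Away (MvPolynomial.homogeneousSubmodule τ ℂ)
      (MvPolynomial.X k : MvPolynomial τ ℂ)) :=
  Spec.map (CommRingCat.ofHom (Away.map (linearPullback q) (MvPolynomial.X k)))

theorem mem_range_sourceChart (q : (σ → ℂ) →ₗ[ℂ] (τ → ℂ)) (k : τ) (x : ProjSpace σ) :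
    x ∈ Set.range (sourceChart q k) ↔ linearForm q k ∉ x.asHomogeneousIdeal := by
  have h := Proj.opensRange_awayι (MvPolynomial.homogeneousSubmodule σ ℂ) _
    (linearPullback_X_mem q k) zero_lt_one
  rw [← linearPullback_X]
  exact iff_of_eq (congrArg (x ∈ ·) h)

/-- The chart `sourceChart`, as a chart of the complement of the centre. -/
def offCentreChart (q : (σ → ℂ) →ₗ[ℂ] (τ → ℂ)) (k : τ) :
    Spec (.of <| Away (MvPolynomial.homogeneousSubmodule σ ℂ)
      (linearPullback q (MvPolynomial.X k))) ⟶ (offCentre q).toScheme :=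
  IsOpenImmersion.lift (offCentre q).ι (sourceChart q k) (by
    rintro x hx
    rw [Scheme.Opens.range_ι]
    exact (mem_offCentre_iff q x).mpr ⟨k, (mem_range_sourceChart q k x).mp hx⟩)

theorem offCentreChart_ι (q : (σ → ℂ) →ₗ[ℂ] (τ → ℂ)) (k : τ) :
    offCentreChart q k ≫ (offCentre q).ι = sourceChart q k :=
  IsOpenImmersion.lift_fac _ _ _

theorem offCentreChart_ι_assoc (q : (σ → ℂ) →ₗ[ℂ] (τ → ℂ)) (k : τ) {Z : Scheme}
    (h : ProjSpace σ ⟶ Z) :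
    offCentreChart q k ≫ (offCentre q).ι ≫ h = sourceChart q k ≫ h := by
  rw [← Category.assoc, offCentreChart_ι]

instance (q : (σ → ℂ) →ₗ[ℂ] (τ → ℂ)) (k : τ) : IsOpenImmersion (offCentreChart q k) := by
  have : IsOpenImmersion (offCentreChart q k ≫ (offCentre q).ι) := by
    rw [offCentreChart_ι]
    infer_instance
  exact IsOpenImmersion.of_comp _ (offCentre q).ι

theorem mem_range_offCentreChart (q : (σ → ℂ) →ₗ[ℂ] (τ → ℂ)) (k : τ) (x : (offCentre q).toScheme) :
    x ∈ Set.range (offCentreChart q k) ↔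
      linearForm q k ∉ ((offCentre q).ι x).asHomogeneousIdeal := by
  rw [← mem_range_sourceChart, ← offCentreChart_ι]
  constructor
  · rintro ⟨z, rfl⟩
    exact ⟨z, rfl⟩
  · rintro ⟨z, hz⟩
    exact ⟨z, (offCentre q).ι.injective hz⟩

/-- The affine open cover of the complement of the centre by the charts `offCentreChart`. -/
def offCentreCover (q : (σ → ℂ) →ₗ[ℂ] (τ → ℂ)) : (offCentre q).toScheme.OpenCover :=
  Scheme.Cover.mkOfCovers τ _ (offCentreChart q) (fun x => by
    obtain ⟨k, hk⟩ := (mem_offCentre_iff q _).mp x.2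
    exact ⟨k, (mem_range_offCentreChart q k x).mpr hk⟩) fun k => inferInstance

/-- Pullback commutes with restriction to the overlap where both coordinates are invertible; this is
the ring identity behind the gluing. -/
theorem awayMap_comp_map (q : (σ → ℂ) →ₗ[ℂ] (τ → ℂ)) {k l : τ} {x : MvPolynomial τ ℂ}
    (hx : x = MvPolynomial.X k * MvPolynomial.X l)
    (hx' : linearPullback q x = linearPullback q (MvPolynomial.X k) *
      linearPullback q (MvPolynomial.X l)) :
    (awayMap (MvPolynomial.homogeneousSubmodule σ ℂ)
        (linearPullback_X_mem q l) hx').comp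
      (Away.map (linearPullback q) (MvPolynomial.X k)) =
    (Away.map (linearPullback q) x).comp
      (awayMap (MvPolynomial.homogeneousSubmodule τ ℂ) (X_mem_homogeneousSubmodule l) hx) := by
  ext z
  obtain ⟨n, a, ha, rfl⟩ := Away.mk_surjective _ (X_mem_homogeneousSubmodule k) z
  rw [RingHom.comp_apply, RingHom.comp_apply, Away.map_mk, awayMap_mk, awayMap_mk, Away.map_mk,
    Away.val_mk, Away.val_mk, map_mul, map_pow]

theorem chartMap_comp_targetChart_compatible (q : (σ → ℂ) →ₗ[ℂ] (τ → ℂ)) (k l : τ) :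
    Limits.pullback.fst (offCentreChart q k) (offCentreChart q l) ≫
        chartMap q k ≫ targetChart k =
      Limits.pullback.snd (offCentreChart q k) (offCentreChart q l) ≫
        chartMap q l ≫ targetChart l := by
  have hx' : linearPullback q (MvPolynomial.X k * MvPolynomial.X l) =
      linearPullback q (MvPolynomial.X k) * linearPullback q (MvPolynomial.X l) :=
    map_mul (linearPullback q) _ _
  have hcond : Limits.pullback.fst (offCentreChart q k) (offCentreChart q l) ≫ sourceChart q k =
      Limits.pullback.snd (offCentreChart q k) (offCentreChart q l) ≫ sourceChart q l := by
    rw [← offCentreChart_ι, ← offCentreChart_ι, Limits.pullback.condition_assoc]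
  obtain ⟨m, hm1, hm2⟩ : ∃ m, m ≫ Spec.map (CommRingCat.ofHom
        (awayMap (MvPolynomial.homogeneousSubmodule σ ℂ)
        (linearPullback_X_mem q l) hx')) =
          Limits.pullback.fst (offCentreChart q k) (offCentreChart q l) ∧
        m ≫ Spec.map (CommRingCat.ofHom
        (awayMap (MvPolynomial.homogeneousSubmodule σ ℂ)
        (linearPullback_X_mem q k) (hx'.trans (mul_comm _ _)))) =
          Limits.pullback.snd (offCentreChart q k) (offCentreChart q l) := by
    refine ⟨Limits.pullback.lift _ _ hcond ≫ (Proj.pullbackAwayιIso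
      (MvPolynomial.homogeneousSubmodule σ ℂ)
      (linearPullback_X_mem q k) zero_lt_one
      (linearPullback_X_mem q l) zero_lt_one hx').hom, ?_, ?_⟩
    · rw [Category.assoc, Proj.pullbackAwayιIso_hom_SpecMap_awayMap_left, Limits.pullback.lift_fst]
    · rw [Category.assoc, Proj.pullbackAwayιIso_hom_SpecMap_awayMap_right,
        Limits.pullback.lift_snd]
  rw [← hm1, ← hm2]
  simp only [Category.assoc, chartMap, ← Spec.map_comp_assoc, ← CommRingCat.ofHom_comp]
  rw [awayMap_comp_map q rfl hx', awayMap_comp_map q (mul_comm _ _) (hx'.trans (mul_comm _ _))]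
  simp only [CommRingCat.ofHom_comp, Spec.map_comp_assoc, targetChart]
  rw [Proj.SpecMap_awayMap_awayι, Proj.SpecMap_awayMap_awayι]

/-- The linear projection, as a morphism on the complement of its centre. -/
def linearProjection (q : (σ → ℂ) →ₗ[ℂ] (τ → ℂ)) : (offCentre q).toScheme ⟶ ProjSpace τ :=
  (offCentreCover q).glueMorphisms (fun k => chartMap q k ≫ targetChart k)
    (chartMap_comp_targetChart_compatible q)

theorem offCentreChart_linearProjection (q : (σ → ℂ) →ₗ[ℂ] (τ → ℂ)) (k : τ) :
    offCentreChart q k ≫ linearProjection q = chartMap q k ≫ targetChart k :=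
  (offCentreCover q).ι_glueMorphisms _ (chartMap_comp_targetChart_compatible q) k

theorem offCentreChart_linearProjection_assoc (q : (σ → ℂ) →ₗ[ℂ] (τ → ℂ)) (k : τ) {Z : Scheme}
    (h : ProjSpace τ ⟶ Z) :
    offCentreChart q k ≫ linearProjection q ≫ h = chartMap q k ≫ targetChart k ≫ h := by
  rw [← Category.assoc, offCentreChart_linearProjection, Category.assoc]

/-- On the level of homogeneous primes the projection is contraction along `linearPullback`, at
non-closed points as well. -/
theorem mem_linearProjection_apply (q : (σ → ℂ) →ₗ[ℂ] (τ → ℂ))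
    (x : (offCentre q).toScheme) {d : ℕ} (hd : 0 < d) {F : MvPolynomial τ ℂ}
    (hF : F.IsHomogeneous d) :
    F ∈ (linearProjection q x).asHomogeneousIdeal ↔
      linearPullback q F ∈ ((offCentre q).ι x).asHomogeneousIdeal := by
  obtain ⟨k, hk⟩ := (mem_offCentre_iff q _).mp x.2
  obtain ⟨z, rfl⟩ := (mem_range_offCentreChart q k x).mpr hk
  rw [← Scheme.Hom.comp_apply, ← Scheme.Hom.comp_apply, offCentreChart_linearProjection,
    offCentreChart_ι, Scheme.Hom.comp_apply]
  have h1 := mem_awayι_apply_iff (X_mem_homogeneousSubmodule k) hd hF (chartMap q k z)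
  have h2 := mem_awayι_apply_iff (linearPullback_X_mem q k) hd
    (linearPullback_isHomogeneous q hF) z
  refine h1.trans (Iff.trans ?_ h2.symm)
  have h3 := Away.map_mk (linearPullback q) (MvPolynomial.X k) (X_mem_homogeneousSubmodule k) d F
    (by simpa using hF)
  change Away.map (linearPullback q) (MvPolynomial.X k) _ ∈ z.asIdeal ↔ _
  rw [h3]

theorem linearProjection_over (q : (σ → ℂ) →ₗ[ℂ] (τ → ℂ)) :
    linearProjection q ≫ projSpaceOver τ = (offCentre q).ι ≫ projSpaceOver σ := by
  refine (offCentreCover q).hom_ext _ _ fun (k : τ) => ?_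
  change offCentreChart q k ≫ _ = offCentreChart q k ≫ _
  rw [offCentreChart_linearProjection_assoc, offCentreChart_ι_assoc, projSpaceOver, projSpaceOver,
    Proj.awayι_toSpecZero_assoc, Proj.awayι_toSpecZero_assoc, ← Spec.map_comp, ← Spec.map_comp,
    ← Spec.map_comp]
  congr 1
  ext c
  refine (HomogeneousLocalization.val_mk _).trans (Eq.trans ?_
    (HomogeneousLocalization.val_mk _).symm)
  congr 1
  · exact linearPullback_C q c
  · exact Subtype.ext (map_one (linearPullback q))

theorem isLinearProjection_linearProjection (q : (σ → ℂ) →ₗ[ℂ] (τ → ℂ)) :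
    IsLinearProjection q (linearProjection q) := by
  refine ⟨linearProjection_over q, fun x v hv hx => ?_⟩
  have hq : q v ≠ 0 := by
    obtain ⟨k, hk⟩ := (mem_offCentre_iff q _).mp x.2
    intro h0
    apply hk
    have hx : x.1 = point v hv := hx
    rw [hx, mem_point_iff_of_isHomogeneous (linearForm_isHomogeneous q k), eval_linearForm, h0]
    rfl
  refine ⟨hq, projSpace_ext_of_pos fun d F hd hF => ?_⟩
  rw [mem_linearProjection_apply q x hd hF, hx, mem_point_iff_of_isHomogeneous hF,
    mem_point_iff_of_isHomogeneous (linearPullback_isHomogeneous q hF), eval_linearPullback]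

/-- The preimage of a standard affine chart is again an affine chart, so the projection off its
centre is an affine morphism. -/
theorem linearProjection_preimage_basicOpen (q : (σ → ℂ) →ₗ[ℂ] (τ → ℂ)) (k : τ) :
    linearProjection q ⁻¹ᵁ Proj.basicOpen _ (MvPolynomial.X k) =
      (offCentreChart q k).opensRange := by
  ext x
  have h := mem_linearProjection_apply q x one_pos (MvPolynomial.isHomogeneous_X ℂ k)
  rw [linearPullback_X] at h
  exact (not_congr h).trans (mem_range_offCentreChart q k x).symm

theorem exists_mem_basicOpen_X (x : ProjSpace τ) :
    ∃ k, x ∈ Proj.basicOpen (MvPolynomial.homogeneousSubmodule τ ℂ) (MvPolynomial.X k) :=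
  exists_X_notMem x

instance isAffineHom_linearProjection (q : (σ → ℂ) →ₗ[ℂ] (τ → ℂ)) :
    IsAffineHom (linearProjection q) := by
  refine isAffineHom_of_forall_exists_isAffineOpen _ fun y => ?_
  obtain ⟨k, hk⟩ := exists_mem_basicOpen_X y
  refine ⟨_, hk, Proj.isAffineOpen_basicOpen _ _ (X_mem_homogeneousSubmodule k) one_pos, ?_⟩
  rw [linearProjection_preimage_basicOpen]
  exact isAffineOpen_opensRange _

/-- `Proj` is proper over the spectrum of the degree-zero part, and that part is ℂ itself. -/
instance isProper_projSpaceOver (σ : Type) [Finite σ] : IsProper (projSpaceOver σ) := by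
  have h1 : Function.Bijective (algebraMap ℂ (MvPolynomial.homogeneousSubmodule σ ℂ 0)) := by
    refine ⟨fun a b hab => MvPolynomial.C_injective σ ℂ (congrArg Subtype.val hab),
      fun ⟨F, hF⟩ => ?_⟩
    have hF' : F.IsHomogeneous 0 := hF
    rw [← MvPolynomial.totalDegree_zero_iff_isHomogeneous,
      MvPolynomial.totalDegree_eq_zero_iff_eq_C] at hF'
    exact ⟨F.coeff 0, Subtype.ext hF'.symm⟩
  have : IsIso (CommRingCat.ofHom (algebraMap ℂ (MvPolynomial.homogeneousSubmodule σ ℂ 0))) := by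
    rw [ConcreteCategory.isIso_iff_bijective]
    exact h1
  have : IsScalarTower ℂ (MvPolynomial.homogeneousSubmodule σ ℂ 0) (MvPolynomial σ ℂ) :=
    ⟨fun a b c => smul_mul_assoc a (b : MvPolynomial σ ℂ) c⟩
  have : Algebra.FiniteType (MvPolynomial.homogeneousSubmodule σ ℂ 0) (MvPolynomial σ ℂ) :=
    Algebra.FiniteType.of_restrictScalars_finiteType ℂ _ _
  unfold projSpaceOver
  infer_instance

end LinearProjection

/-! ### Plücker vectors with given Jacobian: elimination -/

section Elimination

open Polynomial

/-- The Plücker coordinates of a pair of vectors. -/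
def wedge {R : Type*} [CommRing R] (a b : Fin 5 → R) (p : PluckerIndex) : R :=
  a p.1.1 * b p.1.2 - a p.1.2 * b p.1.1

/-- The coordinate `p_ij`, `i < j`. -/
abbrev idx (i j : Fin 5) (h : i < j := by decide) : PluckerIndex := ⟨(i, j), h⟩

/-- The coefficients of the Jacobian sextic in terms of the Plücker coordinates, up to constant
factors. -/
def sextic {R : Type*} [CommRing R] (p : PluckerIndex → R) : Fin 7 → R :=
  ![p (idx 0 1), p (idx 0 2), p (idx 0 3) + 2 * p (idx 1 2), p (idx 0 4) + 8 * p (idx 1 3),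
    p (idx 1 4) + 2 * p (idx 2 3), p (idx 2 4), p (idx 3 4)]

variable {R : Type*} [CommRing R] (z : Fin 7 → R)

/-- The coefficient of `p₁₃` in the equation that expresses `p₁₃` in terms of `p₁₂`. -/
def elimL : R[X] := C (2 * z 1 ^ 2) - C (8 * z 0) * X

/-- The constant term in the equation that expresses `p₁₃` in terms of `p₁₂`. -/
def elimN : R[X] :=
  C (z 0 ^ 2 * z 5 - z 0 * z 1 * z 4) + C (z 0 * z 3 - 2 * z 1 * z 2) * X + C (4 * z 1) * X ^ 2

/-- The quintic equation for `p₁₂`. -/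
def quintic : R[X] :=
  elimL z ^ 2 * (C (z 0 ^ 2 * z 6) -
      (C (z 2) - C 2 * X) * (C (z 0 * z 4) + C (2 * z 2) * X - C 4 * X ^ 2)) -
    elimN z * elimL z * (C (2 * z 1) * (C (z 2) - C 2 * X) + C (z 0 * z 3)) -
    C (8 * z 0) * elimN z ^ 2

/-- The value of `elimN` at the root of `elimL`, up to a factor. -/
def elimNorm : R :=
  4 * z 0 ^ 4 * z 5 - 4 * z 0 ^ 3 * z 1 * z 4 + z 0 ^ 2 * z 3 * z 1 ^ 2 -
    2 * z 0 * z 1 ^ 3 * z 2 + z 1 ^ 5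

/-- The polynomial whose nonvanishing ensures that there are five Plücker vectors with given
Jacobian. -/
def branch : R := z 0 * elimNorm z * resultant (quintic z) (derivative (quintic z)) 5 4

theorem natDegree_quintic_le : (quintic z).natDegree ≤ 5 := by
  unfold quintic elimL elimN
  compute_degree

theorem coeff_quintic : (quintic z).coeff 5 = -512 * z 0 ^ 2 := by
  -- Degree 5 arises only from (8 z₀ X)² · (-8 X³) in the first product; splitting off that term
  -- leaves a remainder of degree at most 4.
  have : quintic z = C (-512 * z 0 ^ 2) * X ^ 5 +
      (elimL z ^ 2 * (C (z 0 ^ 2 * z 6 - z 2 * z 0 * z 4) +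
          C (2 * z 0 * z 4 - 2 * z 2 ^ 2) * X + C (8 * z 2) * X ^ 2) +
        C (256 * z 0 * z 1 ^ 2) * X ^ 4 - C (32 * z 1 ^ 4) * X ^ 3 -
        elimN z * elimL z * (C (2 * z 1) * (C (z 2) - C 2 * X) + C (z 0 * z 3)) -
        C (8 * z 0) * elimN z ^ 2) := by
    unfold quintic elimL
    simp only [map_mul, map_sub, map_pow, map_neg, map_ofNat]
    ring
  rw [this, coeff_add, coeff_C_mul_X_pow, if_pos rfl, add_eq_left]
  refine coeff_eq_zero_of_natDegree_lt (Nat.lt_succ_of_le ?_)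
  unfold elimL elimN
  compute_degree

theorem map_quintic {S : Type*} [CommRing S] (f : R →+* S) :
    (quintic z).map f = quintic fun i => f (z i) := by
  simp only [quintic, elimL, elimN, Polynomial.map_sub, Polynomial.map_mul, Polynomial.map_pow,
    Polynomial.map_add, Polynomial.map_ofNat, map_C, map_X, map_mul, map_sub, map_pow,
    map_ofNat]

/-- The resultant is taken with fixed formal degrees 5 and 4, so it commutes with every ring
homomorphism even where the degree of the quintic drops. -/
theorem map_branch {S : Type*} [CommRing S] (f : R →+* S) :
    f (branch z) = branch fun i => f (z i) := by
  rw [branch, map_mul, map_mul, ← resultant_map_map, ← derivative_map, map_quintic, branch]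
  simp only [elimNorm, map_mul, map_sub, map_add, map_pow, map_ofNat]

theorem eval_elimL (u : R) : (elimL z).eval u = 2 * z 1 ^ 2 - 8 * z 0 * u := by
  simp [elimL]

theorem eval_elimN (u : R) : (elimN z).eval u =
    z 0 ^ 2 * z 5 - z 0 * z 1 * z 4 + (z 0 * z 3 - 2 * z 1 * z 2) * u + 4 * z 1 * u ^ 2 := by
  simp [elimN]

theorem eval_quintic (u : R) : (quintic z).eval u =
    (elimL z).eval u ^ 2 * (z 0 ^ 2 * z 6 -
      (z 2 - 2 * u) * (z 0 * z 4 + 2 * z 2 * u - 4 * u ^ 2)) -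
    (elimN z).eval u * (elimL z).eval u * (2 * z 1 * (z 2 - 2 * u) + z 0 * z 3) -
    8 * z 0 * (elimN z).eval u ^ 2 := by
  simp [quintic]

end Elimination

/-! ### The five Plücker vectors over a general sextic -/

section FiveSolutions

open Polynomial

variable {z : Fin 7 → ℂ}

/-- The resultant is a combination of the quintic and its derivative; dividing by it gives a Bézout
identity. -/
theorem separable_quintic (hz : branch z ≠ 0) : (quintic z).Separable := by
  have hres : resultant (quintic z) (derivative (quintic z)) 5 4 ≠ 0 := right_ne_zero_of_mul hz
  obtain ⟨p, q, -, -, h⟩ := exists_mul_add_mul_eq_C_resultant (quintic z)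
    (derivative (quintic z)) (natDegree_quintic_le z)
    ((natDegree_derivative_le _).trans (by have := natDegree_quintic_le z; omega))
    (Or.inl (by norm_num) : (5 : ℕ) ≠ 0 ∨ (4 : ℕ) ≠ 0)
  refine ⟨C (resultant (quintic z) (derivative (quintic z)) 5 4)⁻¹ * p,
    C (resultant (quintic z) (derivative (quintic z)) 5 4)⁻¹ * q, ?_⟩
  have h2 : C (resultant (quintic z) (derivative (quintic z)) 5 4)⁻¹ *
      C (resultant (quintic z) (derivative (quintic z)) 5 4) = 1 := by
    rw [← C_mul, inv_mul_cancel₀ hres, C_1]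
  linear_combination C (resultant (quintic z) (derivative (quintic z)) 5 4)⁻¹ * h + h2

theorem card_roots_quintic (hz : branch z ≠ 0) : (quintic z).roots.toFinset.card = 5 := by
  have h0 : z 0 ≠ 0 := left_ne_zero_of_mul (left_ne_zero_of_mul hz)
  have hdeg : (quintic z).natDegree = 5 :=
    natDegree_eq_of_le_of_coeff_ne_zero (natDegree_quintic_le z) (by
      rw [coeff_quintic]
      exact mul_ne_zero (by norm_num) (pow_ne_zero 2 h0))
  rw [Multiset.toFinset_card_of_nodup (nodup_roots (separable_quintic hz)),
    ← (IsAlgClosed.splits (quintic z)).natDegree_eq_card_roots, hdeg]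

/-- The only root of `elimL` is z₁² / (4 z₀), and there `elimN` takes the value `elimNorm z` / (4
z₀²). -/
theorem elim_ne_zero (hz : branch z ≠ 0) {u : ℂ}
    (h : (elimL z).eval u = 0) : (elimN z).eval u ≠ 0 := by
  have h0 : z 0 ≠ 0 := left_ne_zero_of_mul (left_ne_zero_of_mul hz)
  have hn : elimNorm z ≠ 0 := right_ne_zero_of_mul (left_ne_zero_of_mul hz)
  intro hN
  apply hn
  rw [eval_elimL] at h
  rw [eval_elimN] at hN
  unfold elimNorm
  have hu : u = z 1 ^ 2 / (4 * z 0) := by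
    field_simp
    linear_combination -h / 2
  rw [hu] at hN
  field_simp at hN
  linear_combination hN

/-- These are the Plücker relations on the indices 0123, 0124 and 0134, with p₀₃ = z₂ - 2p₁₂, p₀₄ =
z₃ - 8p₁₃, p₁₄ = z₄ - 2p₂₃. The last two are multiplied by z₀, and in the second z₀p₂₃ is eliminated
by the first. -/
theorem branch_relations {p : PluckerIndex → ℂ} {a b : Fin 5 → ℂ} (hp : p = wedge a b)
    (hs : sextic p = z) :
    z 0 * p (idx 2 3) = z 1 * p (idx 1 3) - (z 2 - 2 * p (idx 1 2)) * p (idx 1 2) ∧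
    (elimL z).eval (p (idx 1 2)) * p (idx 1 3) + (elimN z).eval (p (idx 1 2)) = 0 ∧
    z 0 ^ 2 * z 6 - (z 2 - 2 * p (idx 1 2)) *
      (z 0 * z 4 - 2 * (z 0 * p (idx 2 3))) + z 0 * (z 3 - 8 * p (idx 1 3)) * p (idx 1 3) = 0 := by
  subst hs
  rw [eval_elimL, eval_elimN]
  subst hp
  simp [sextic, wedge]
  refine ⟨?_, ?_, ?_⟩ <;> ring

theorem quintic_eq_zero {p : PluckerIndex → ℂ} {a b : Fin 5 → ℂ} (hp : p = wedge a b)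
    (hs : sextic p = z) : (quintic z).eval (p (idx 1 2)) = 0 := by
  obtain ⟨h1, h2, h3⟩ := branch_relations hp hs
  rw [eval_quintic]
  rw [h1] at h3
  generalize (elimL z).eval (p (idx 1 2)) = L at *
  generalize (elimN z).eval (p (idx 1 2)) = N at *
  generalize p (idx 1 2) = u at *
  generalize p (idx 1 3) = v at *
  have hN : N = -(L * v) := by linear_combination h2
  subst hN
  linear_combination L ^ 2 * h3

theorem elimL_ne_zero {p : PluckerIndex → ℂ} {a b : Fin 5 → ℂ} (hz : branch z ≠ 0)
    (hp : p = wedge a b) (hs : sextic p = z) : (elimL z).eval (p (idx 1 2)) ≠ 0 := by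
  obtain ⟨-, h2, -⟩ := branch_relations hp hs
  intro h
  rw [h, zero_mul, zero_add] at h2
  exact elim_ne_zero hz h h2

/-- The set of Plücker vectors with given Jacobian. -/
def solutions (z : Fin 7 → ℂ) : Set (PluckerIndex → ℂ) :=
  {p | (∃ a b, p = wedge a b) ∧ sextic p = z}

/-- Back substitution: v is determined by L v + N = 0, then w by the first relation; the third
relation holds because L² can be cancelled from the quintic. -/
theorem exists_solution (hz : branch z ≠ 0) {u : ℂ} (hu : (quintic z).eval u = 0) :
    ∃ p ∈ solutions z, p (idx 1 2) = u := by
  have h0 : z 0 ≠ 0 := left_ne_zero_of_mul (left_ne_zero_of_mul hz)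
  have hL : (elimL z).eval u ≠ 0 := by
    intro hL
    have hN := elim_ne_zero hz hL
    rw [eval_quintic, hL] at hu
    simp [h0, hN] at hu
  rw [eval_quintic] at hu
  obtain ⟨v, hv⟩ : ∃ v, (elimL z).eval u * v + (elimN z).eval u = 0 :=
    ⟨-(elimN z).eval u / (elimL z).eval u, by field_simp; ring⟩
  obtain ⟨w, hw⟩ : ∃ w, z 0 * w = z 1 * v - (z 2 - 2 * u) * u :=
    ⟨(z 1 * v - (z 2 - 2 * u) * u) / z 0, by field_simp⟩
  have hq : z 0 ^ 2 * z 6 - (z 2 - 2 * u) * (z 0 * z 4 - 2 * (z 0 * w)) +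
      z 0 * (z 3 - 8 * v) * v = 0 := by
    have : (elimL z).eval u ^ 2 * (z 0 ^ 2 * z 6 - (z 2 - 2 * u) * (z 0 * z 4 - 2 * (z 0 * w)) +
      z 0 * (z 3 - 8 * v) * v) = 0 := by
      rw [hw]
      generalize (elimL z).eval u = L at *
      generalize (elimN z).eval u = N at *
      have hN : N = -(L * v) := by linear_combination hv
      subst hN
      linear_combination hu
    exact (mul_eq_zero.mp this).resolve_left (pow_ne_zero 2 hL)
  rw [eval_elimL, eval_elimN] at hv
  -- With a = (z₀, 0, ...) and b = (0, 1, ...) one has p₀₁ = z₀, p₀ⱼ = z₀bⱼ and p₁ⱼ = -aⱼ for j ≥ 2,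
  -- so the pair is read off from the wanted p₀ⱼ and p₁ⱼ. The remaining coordinates come out right
  -- by the three relations.
  refine ⟨wedge ![z 0, 0, -u, -v, -(z 4 - 2 * w)]
    ![0, 1, z 1 / z 0, (z 2 - 2 * u) / z 0, (z 3 - 8 * v) / z 0], ⟨⟨_, _, rfl⟩, ?_⟩, ?_⟩
  · have hw' : w = (z 1 * v - (z 2 - 2 * u) * u) / z 0 := by
      field_simp
      linear_combination hw
    funext i
    fin_cases i <;> simp [sextic, wedge]
    all_goals field_simp
    · ring
    · ring
    · linear_combination -2 * hw
    · refine mul_left_cancel₀ h0 ?_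
      linear_combination -hv - 2 * z 1 * hw
    · refine mul_left_cancel₀ h0 ?_
      linear_combination -hq
  · simp [wedge]

/-- The value of p₁₂ determines p₁₃ since L ≠ 0, then p₂₃ since z₀ ≠ 0; the sextic gives all other
coordinates. -/
theorem solutions_injOn (hz : branch z ≠ 0) :
    Set.InjOn (fun p : PluckerIndex → ℂ => p (idx 1 2)) (solutions z) := by
  rintro p ⟨⟨a, b, hp⟩, hs⟩ p' ⟨⟨a', b', hp'⟩, hs'⟩ (h : p (idx 1 2) = p' (idx 1 2))
  have h0 : z 0 ≠ 0 := left_ne_zero_of_mul (left_ne_zero_of_mul hz)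
  obtain ⟨h1, h2, -⟩ := branch_relations hp hs
  obtain ⟨h1', h2', -⟩ := branch_relations hp' hs'
  have hL := elimL_ne_zero hz hp hs
  rw [← h] at h1' h2'
  have hv : p (idx 1 3) = p' (idx 1 3) :=
    mul_left_cancel₀ hL (by linear_combination h2 - h2')
  have hw : p (idx 2 3) = p' (idx 2 3) := mul_left_cancel₀ h0 (by rw [h1, h1', hv])
  have hs2 := hs.trans hs'.symm
  have e := fun i => congrFun hs2 i
  have e0 := e 0
  have e1 := e 1
  have e2 := e 2
  have e3 := e 3
  have e4 := e 4
  have e5 := e 5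
  have e6 := e 6
  simp [sextic, h, hv, hw] at e0 e1 e2 e3 e4 e5 e6
  funext ⟨⟨i, j⟩, hij⟩
  fin_cases i <;> fin_cases j <;> first | assumption | exact absurd hij (by decide)

theorem bijOn_solutions (hz : branch z ≠ 0) :
    Set.BijOn (fun p : PluckerIndex → ℂ => p (idx 1 2)) (solutions z)
      (quintic z).roots.toFinset := by
  have hne : quintic z ≠ 0 := (separable_quintic hz).ne_zero
  refine ⟨?_, solutions_injOn hz, ?_⟩
  · rintro p ⟨⟨a, b, hp⟩, hs⟩
    simpa [hne] using quintic_eq_zero hp hs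
  · intro u hu
    simp [hne] at hu
    exact exists_solution hz hu

theorem ncard_solutions (hz : branch z ≠ 0) : (solutions z).ncard = 5 := by
  rw [← card_roots_quintic hz, ← Set.ncard_coe_finset, ← (bijOn_solutions hz).image_eq,
    (solutions_injOn hz).ncard_image]

/-- The functions `1, p₁₂, p₁₃, p₂₃, p₁₃²` are linearly independent on the set of Plücker vectors
with given general Jacobian. -/
theorem eq_zero_of_forall_solutions (hz : branch z ≠ 0) {α : Fin 5 → ℂ}
    (hα : ∀ p ∈ solutions z, α 0 + α 1 * p (idx 1 2) + α 2 * p (idx 1 3) + α 3 * p (idx 2 3) +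
      α 4 * p (idx 1 3) ^ 2 = 0) : α = 0 := by
  have h0 : z 0 ≠ 0 := left_ne_zero_of_mul (left_ne_zero_of_mul hz)
  set L := elimL z with hLdef
  set N := elimN z with hNdef
  -- F is z₀L² times the given combination, with p₁₃ = -N/L and z₀p₂₃ = z₁p₁₃ - (z₂ - 2X)X
  -- substituted. Its degree is at most 4, yet it vanishes at five roots.
  set F : ℂ[X] := C (z 0) * L ^ 2 * (C (α 0) + C (α 1) * X) - C (z 0 * α 2) * N * L -
    C (α 3) * L * (C (z 1) * N + (C (z 2) - C 2 * X) * X * L) + C (z 0 * α 4) * N ^ 2 with hF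
  have hdeg : F.natDegree ≤ 4 := by
    rw [hF, hLdef, hNdef]
    unfold elimL elimN
    compute_degree
  have hF0 : F = 0 := by
    refine eq_zero_of_natDegree_lt_card_of_eval_eq_zero' F (quintic z).roots.toFinset ?_ ?_
    · intro u hu
      obtain ⟨p, hp, rfl⟩ := (bijOn_solutions hz).surjOn hu
      have h := hα p hp
      obtain ⟨⟨a, b, hp⟩, hs⟩ := hp
      obtain ⟨h1, h2, -⟩ := branch_relations hp hs
      simp only [hF, eval_add, eval_sub, eval_mul, eval_pow, eval_C, eval_X]
      rw [← hLdef, ← hNdef] at h2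
      generalize L.eval _ = l at *
      generalize N.eval _ = n at *
      simp only at *
      generalize p (idx 1 2) = u at *
      generalize p (idx 1 3) = v at *
      generalize p (idx 2 3) = w at *
      have hn : n = -(l * v) := by linear_combination h2
      subst hn
      linear_combination z 0 * l ^ 2 * h - α 3 * l ^ 2 * h1
    · rw [card_roots_quintic hz]
      omega
  -- At the root of L, where N does not vanish, only the α₄ term of F survives. Then L can be
  -- cancelled, and the same evaluation relates α₂ and α₃.
  obtain ⟨ρ, hρ⟩ : ∃ ρ, L.eval ρ = 0 := ⟨z 1 ^ 2 / (4 * z 0), by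
    rw [hLdef, eval_elimL]; field_simp; ring⟩
  have hN := elim_ne_zero hz hρ
  have hL0 : L ≠ 0 := by
    intro h
    have e0 := eval_elimL z 0
    have e1 := eval_elimL z 1
    rw [← hLdef, h, eval_zero] at e0 e1
    exact h0 (by linear_combination (e1 - e0) / 8)
  have h4 : α 4 = 0 := by
    have := congrArg (eval ρ) hF0
    simpa [hF, hρ, h0, show eval ρ N ≠ 0 from hN] using this
  have hF1 : C (z 0) * L * (C (α 0) + C (α 1) * X) - C (z 0 * α 2) * N -
      C (α 3) * (C (z 1) * N + (C (z 2) - C 2 * X) * X * L) = 0 := by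
    refine mul_left_cancel₀ hL0 ?_
    rw [mul_zero]
    refine Eq.trans ?_ hF0
    rw [hF, h4, mul_zero, C_0]
    ring
  have h23 : z 0 * α 2 + α 3 * z 1 = 0 := by
    have := congrArg (eval ρ) hF1
    simp [hρ] at this
    exact (mul_eq_zero.mp (by linear_combination -this :
      (z 0 * α 2 + α 3 * z 1) * N.eval ρ = 0)).resolve_right hN
  have hF2 : C (z 0) * (C (α 0) + C (α 1) * X) - C (α 3) * (C (z 2) - C 2 * X) * X = 0 := by
    refine mul_left_cancel₀ hL0 ?_
    have : C (z 0 * α 2) + C (α 3) * C (z 1) = (0 : ℂ[X]) := by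
      rw [← C_mul, ← C_add, h23, C_0]
    linear_combination hF1 + N * this
  -- What remains is a quadratic polynomial; its values at 0, 1 and -1 show that its coefficients
  -- vanish.
  have c0 := congrArg (fun P => eval 0 P) hF2
  have c1 := congrArg (fun P => eval 1 P) hF2
  have c2 := congrArg (fun P => eval (-1) P) hF2
  simp [h0] at c0 c1 c2
  rw [c0] at c1 c2
  have h3 : α 3 = 0 := by linear_combination (c1 + c2) / 4
  rw [h3] at h23 c1
  simp [h0] at h23 c1
  funext i
  fin_cases i <;> assumption

/-- The branch polynomial is not the zero polynomial. -/
theorem branch_ne_zero : branch ![(1 : ℂ), 0, 0, 0, 0, 8, 0] ≠ 0 := by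
  -- For this sextic L = -8X and N = 8, so the quintic is a multiple of X⁵ + 1, which is visibly
  -- separable.
  have hq : quintic ![(1 : ℂ), 0, 0, 0, 0, 8, 0] = C (-512) * (X ^ 5 + 1) := by
    simp [quintic, elimL, elimN]
    simp only [map_ofNat]
    ring
  have hd : derivative (quintic ![(1 : ℂ), 0, 0, 0, 0, 8, 0]) = C (-512) * (C 5 * X ^ 4) := by
    rw [hq, derivative_C_mul, derivative_add, derivative_X_pow, derivative_one, add_zero]
    norm_num
  have hdeg : (quintic ![(1 : ℂ), 0, 0, 0, 0, 8, 0]).natDegree = 5 := by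
    rw [hq]
    compute_degree!
  have hdeg' : (derivative (quintic ![(1 : ℂ), 0, 0, 0, 0, 8, 0])).natDegree = 4 := by
    rw [hd]
    compute_degree!
  have hcop : IsCoprime (quintic ![(1 : ℂ), 0, 0, 0, 0, 8, 0])
      (derivative (quintic ![(1 : ℂ), 0, 0, 0, 0, 8, 0])) := by
    refine ⟨C (-512)⁻¹, - (C (-512)⁻¹ * C 5⁻¹ * X), ?_⟩
    have h1 : (C (-512)⁻¹ * C (-512) : ℂ[X]) = 1 := by rw [← C_mul]; norm_num
    have h2 : (C 5⁻¹ * C 5 : ℂ[X]) = 1 := by rw [← C_mul]; norm_num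
    rw [hd, hq]
    linear_combination (X ^ 5 + 1 - C 5⁻¹ * C 5 * X ^ 5) * h1 - X ^ 5 * h2
  have hres := resultant_ne_zero _ _ hcop
  rw [hdeg, hdeg'] at hres
  refine mul_ne_zero (mul_ne_zero ?_ ?_) hres
  · simp
  · simp [elimNorm]

end FiveSolutions

/-! ### The homogeneous coordinate ring of the Plücker variety -/

section CoordinateRing

open MvPolynomial

/-- The generic point of the space of pairs of vectors gives the ring homomorphism
`p_ij ↦ a_i b_j - a_j b_i`. -/
def genericPlucker : MvPolynomial PluckerIndex ℂ →ₐ[ℂ] MvPolynomial (Fin 2 × Fin 5) ℂ :=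
  aeval (wedge (fun i => X (0, i)) fun i => X (1, i))

/-- The homogeneous ideal of the Plücker variety. -/
def pluckerIdeal : Ideal (MvPolynomial PluckerIndex ℂ) :=
  RingHom.ker genericPlucker

instance isPrime_pluckerIdeal : pluckerIdeal.IsPrime :=
  RingHom.ker_isPrime _

theorem aeval_wedge_eq {R : Type*} [CommRing R] [Algebra ℂ R] (a b : Fin 5 → R)
    (F : MvPolynomial PluckerIndex ℂ) :
    aeval (wedge a b) F = aeval (fun x : Fin 2 × Fin 5 => ![a, b] x.1 x.2) (genericPlucker F) := by
  rw [genericPlucker, ← AlgHom.comp_apply, comp_aeval]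
  congr 2
  funext p
  simp [wedge]

theorem aeval_wedge_eq_zero {R : Type*} [CommRing R] [Algebra ℂ R] (a b : Fin 5 → R)
    {F : MvPolynomial PluckerIndex ℂ} (hF : F ∈ pluckerIdeal) : aeval (wedge a b) F = 0 := by
  rw [aeval_wedge_eq, RingHom.mem_ker.mp hF, map_zero]

/-- A polynomial over an infinite field is zero when all its values are, so identities in the
coordinate ring can be checked on numerical pairs of vectors. -/
theorem mem_pluckerIdeal_iff {F : MvPolynomial PluckerIndex ℂ} :
    F ∈ pluckerIdeal ↔ ∀ a b : Fin 5 → ℂ, eval (wedge a b) F = 0 := by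
  refine ⟨fun h a b => aeval_wedge_eq_zero a b h, fun h => ?_⟩
  refine RingHom.mem_ker.mpr (MvPolynomial.funext fun x => ?_)
  have := aeval_wedge_eq (fun i => x (0, i)) (fun i => x (1, i)) F
  rw [aeval_eq_eval, h, aeval_eq_eval] at this
  rw [map_zero, this]
  congr 2
  funext ⟨i, j⟩
  fin_cases i <;> rfl

/-- Scaling one of the two vectors scales their wedge, so the decomposable vectors form a cone. -/
theorem homogeneousComponent_mem_pluckerIdeal {F : MvPolynomial PluckerIndex ℂ}
    (hF : F ∈ pluckerIdeal) (d : ℕ) : homogeneousComponent d F ∈ pluckerIdeal := by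
  rw [mem_pluckerIdeal_iff] at hF ⊢
  intro a b
  have h : restrictToLine (wedge a b) F = 0 := by
    rw [restrictToLine_eq_zero_iff]
    intro c
    rw [← hF (c • a) b]
    congr 2
    funext p
    simp only [wedge, Pi.smul_apply, smul_eq_mul]
    ring
  rw [← coeff_restrictToLine, h, Polynomial.coeff_zero]

/-- The factors by which the coefficients of the Jacobian sextic differ from `sextic`. -/
def sexticFactor : Fin 7 → ℂ := ![16, 48, 48, 16, 48, 48, 16]

theorem sexticFactor_ne_zero (i : Fin 7) : sexticFactor i ≠ 0 := by
  fin_cases i <;> simp [sexticFactor]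

/-- The Jacobian sextic as a linear function of the Plücker coordinates. -/
def jacobianMap : (PluckerIndex → ℂ) →ₗ[ℂ] (Fin 7 → ℂ) where
  toFun p i := sexticFactor i * sextic p i
  map_add' p p' := by
    funext i
    fin_cases i <;> simp [sextic] <;> ring
  map_smul' c p := by
    funext i
    fin_cases i <;> simp [sextic] <;> ring

theorem jacobianMap_eq_iff {p : PluckerIndex → ℂ} {y : Fin 7 → ℂ} :
    jacobianMap p = y ↔ sextic p = fun i => (sexticFactor i)⁻¹ * y i := by
  rw [funext_iff, funext_iff]
  refine forall_congr' fun i => ?_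
  change sexticFactor i * sextic p i = _ ↔ _
  have := sexticFactor_ne_zero i
  constructor
  · rintro h
    rw [← h]
    field_simp
  · rintro h
    rw [h]
    field_simp

theorem jacobianMap_surjective : Function.Surjective jacobianMap := by
  intro y
  set z : Fin 7 → ℂ := fun i => (sexticFactor i)⁻¹ * y i with hz
  refine ⟨fun p => if p = idx 0 1 then z 0 else if p = idx 0 2 then z 1 else
    if p = idx 0 3 then z 2 else if p = idx 0 4 then z 3 else if p = idx 1 4 then z 4 else
    if p = idx 2 4 then z 5 else if p = idx 3 4 then z 6 else 0, ?_⟩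
  rw [jacobianMap_eq_iff, ← hz]
  funext i
  fin_cases i <;> simp [sextic, idx]

/-- Multiplication by a sextic coefficient is multiplication by a scalar of the base ring. -/
theorem sextic_X (i : Fin 7) :
    sextic (X : PluckerIndex → MvPolynomial PluckerIndex ℂ) i =
      linearPullback jacobianMap (C (sexticFactor i)⁻¹ * X i) := by
  refine MvPolynomial.funext fun v => ?_
  rw [eval_linearPullback, map_mul, eval_C, eval_X]
  change _ = (sexticFactor i)⁻¹ * (sexticFactor i * sextic v i)
  rw [inv_mul_cancel_left₀ (sexticFactor_ne_zero i)]
  fin_cases i <;> simp [sextic]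

/-- A basis of the homogeneous coordinate ring over the polynomial ring in the coefficients of the
Jacobian sextic. -/
def moduleBasis : Fin 5 → MvPolynomial PluckerIndex ℂ :=
  ![1, X (idx 1 2), X (idx 1 3), X (idx 2 3), X (idx 1 3) ^ 2]

/-- The degrees of the elements of `moduleBasis`. -/
def basisDegree : Fin 5 → ℕ := ![0, 1, 1, 1, 2]

theorem moduleBasis_isHomogeneous (i : Fin 5) : (moduleBasis i).IsHomogeneous (basisDegree i) := by
  fin_cases i
  · exact isHomogeneous_one _ _
  · exact isHomogeneous_X _ _
  · exact isHomogeneous_X _ _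
  · exact isHomogeneous_X _ _
  · exact isHomogeneous_X_pow _ _

/-- `F` is congruent to a linear combination of `moduleBasis`. -/
def IsSpanned (F : MvPolynomial PluckerIndex ℂ) : Prop :=
  ∃ c : Fin 5 → MvPolynomial (Fin 7) ℂ,
    F - ∑ i, linearPullback jacobianMap (c i) * moduleBasis i ∈ pluckerIdeal

namespace IsSpanned

variable {F G : MvPolynomial PluckerIndex ℂ}

theorem add (hF : IsSpanned F) (hG : IsSpanned G) : IsSpanned (F + G) := by
  obtain ⟨c, hc⟩ := hF
  obtain ⟨c', hc'⟩ := hG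
  refine ⟨c + c', ?_⟩
  convert add_mem hc hc' using 1
  simp only [Pi.add_apply, map_add, add_mul, Finset.sum_add_distrib]
  ring

theorem mul_left (hF : IsSpanned F) (b : MvPolynomial (Fin 7) ℂ) :
    IsSpanned (linearPullback jacobianMap b * F) := by
  obtain ⟨c, hc⟩ := hF
  refine ⟨fun i => b * c i, ?_⟩
  convert pluckerIdeal.mul_mem_left (linearPullback jacobianMap b) hc using 1
  simp only [map_mul, mul_sub, Finset.mul_sum, mul_assoc]

theorem sextic_mul (hF : IsSpanned F) (i : Fin 7) :
    IsSpanned (sextic (X : PluckerIndex → MvPolynomial PluckerIndex ℂ) i * F) := by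
  rw [sextic_X]
  exact hF.mul_left _

theorem C_mul (hF : IsSpanned F) (c : ℂ) : IsSpanned (C c * F) := by
  rw [← linearPullback_C jacobianMap c]
  exact hF.mul_left _

theorem congr (hG : IsSpanned G) (h : F - G ∈ pluckerIdeal) : IsSpanned F := by
  obtain ⟨c, hc⟩ := hG
  exact ⟨c, by simpa using add_mem h hc⟩

theorem sub (hF : IsSpanned F) (hG : IsSpanned G) : IsSpanned (F - G) := by
  have := hF.add (hG.C_mul (-1))
  rwa [map_neg, map_one, neg_one_mul, ← sub_eq_add_neg] at this

theorem basis (i : Fin 5) : IsSpanned (moduleBasis i) := by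
  refine ⟨Pi.single i 1, ?_⟩
  rw [Finset.sum_eq_single i]
  · simp
  · intro j _ hj
    simp [hj]
  · simp

theorem one : IsSpanned 1 := basis 0
theorem p12 : IsSpanned (X (idx 1 2)) := basis 1
theorem p13 : IsSpanned (X (idx 1 3)) := basis 2
theorem p23 : IsSpanned (X (idx 2 3)) := basis 3
theorem p13_sq : IsSpanned (X (idx 1 3) * X (idx 1 3)) := by
  rw [← sq]
  exact basis 4

/-- The five quadratic reductions from here to `p23_sq` are the Plücker relations 0123, 0124, 0134,
0234, 1234, after p₀₃, p₀₄, p₁₄ have been expressed by sextic coefficients and p₁₂, p₁₃, p₂₃. Only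
0134 involves two products, p₁₂p₂₃ and p₁₃²; keeping p₁₃² as a basis element settles it. -/
theorem p12_sq : IsSpanned (X (idx 1 2) * X (idx 1 2)) := by
  refine congr (((p12.sextic_mul 2).sub (p13.sextic_mul 1)).add (p23.sextic_mul 0) |>.C_mul
    (1 / 2)) (mem_pluckerIdeal_iff.mpr fun a b => ?_)
  simp [sextic, wedge]
  ring

theorem p12_mul_p13 : IsSpanned (X (idx 1 2) * X (idx 1 3)) := by
  refine congr (((((one.sextic_mul 5).sextic_mul 0).sub ((one.sextic_mul 4).sextic_mul 1)).add
    ((p23.sextic_mul 1).C_mul 2)).add (p12.sextic_mul 3) |>.C_mul (1 / 8))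
    (mem_pluckerIdeal_iff.mpr fun a b => ?_)
  simp [sextic, wedge]
  ring

theorem p12_mul_p23 : IsSpanned (X (idx 1 2) * X (idx 2 3)) := by
  refine congr (((((((one.sextic_mul 6).sextic_mul 0).sub ((one.sextic_mul 4).sextic_mul 2)).add
    ((p23.sextic_mul 2).C_mul 2)).add ((p12.sextic_mul 4).C_mul 2)).add (p13.sextic_mul 3)).sub
    (p13_sq.C_mul 8) |>.C_mul (1 / 4))
    (mem_pluckerIdeal_iff.mpr fun a b => ?_)
  simp [sextic, wedge]
  ring

theorem p13_mul_p23 : IsSpanned (X (idx 1 3) * X (idx 2 3)) := by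
  refine congr (((((one.sextic_mul 6).sextic_mul 1).sub ((one.sextic_mul 5).sextic_mul 2)).add
    ((p12.sextic_mul 5).C_mul 2)).add (p23.sextic_mul 3) |>.C_mul (1 / 8))
    (mem_pluckerIdeal_iff.mpr fun a b => ?_)
  simp [sextic, wedge]
  ring

theorem p23_sq : IsSpanned (X (idx 2 3) * X (idx 2 3)) := by
  refine congr (((p12.sextic_mul 6).sub (p13.sextic_mul 5)).add (p23.sextic_mul 4) |>.C_mul (1 / 2))
    (mem_pluckerIdeal_iff.mpr fun a b => ?_)
  simp [sextic, wedge]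
  ring

/-- This is relation 0124 times p₁₃. The other cubic reductions arise likewise: 0234 times p₁₂, 0134
times p₁₃, and 0234 times p₁₃. -/
theorem p12_mul_p13_sq : IsSpanned (X (idx 1 2) * (X (idx 1 3) * X (idx 1 3))) := by
  refine congr (((((p13.sextic_mul 5).sextic_mul 0).sub ((p13.sextic_mul 4).sextic_mul 1)).add
    ((p13_mul_p23.sextic_mul 1).C_mul 2)).add (p12_mul_p13.sextic_mul 3) |>.C_mul (1 / 8))
    (mem_pluckerIdeal_iff.mpr fun a b => ?_)
  simp [sextic, wedge]
  ring

theorem p12_mul_p13_mul_p23 : IsSpanned (X (idx 1 2) * (X (idx 1 3) * X (idx 2 3))) := by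
  refine congr (((((p12.sextic_mul 6).sextic_mul 1).sub ((p12.sextic_mul 5).sextic_mul 2)).add
    ((p12_sq.sextic_mul 5).C_mul 2)).add (p12_mul_p23.sextic_mul 3) |>.C_mul (1 / 8))
    (mem_pluckerIdeal_iff.mpr fun a b => ?_)
  simp [sextic, wedge]
  ring

theorem p13_cube : IsSpanned (X (idx 1 3) * (X (idx 1 3) * X (idx 1 3))) := by
  refine congr (((((((p13.sextic_mul 6).sextic_mul 0).sub ((p13.sextic_mul 4).sextic_mul 2)).add
    ((p13_mul_p23.sextic_mul 2).C_mul 2)).add ((p12_mul_p13.sextic_mul 4).C_mul 2)).add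
    (p13_sq.sextic_mul 3)).sub (p12_mul_p13_mul_p23.C_mul 4) |>.C_mul (1 / 8))
    (mem_pluckerIdeal_iff.mpr fun a b => ?_)
  simp [sextic, wedge]
  ring

theorem p23_mul_p13_sq : IsSpanned (X (idx 2 3) * (X (idx 1 3) * X (idx 1 3))) := by
  refine congr (((((p13.sextic_mul 6).sextic_mul 1).sub ((p13.sextic_mul 5).sextic_mul 2)).add
    ((p12_mul_p13.sextic_mul 5).C_mul 2)).add (p13_mul_p23.sextic_mul 3) |>.C_mul (1 / 8))
    (mem_pluckerIdeal_iff.mpr fun a b => ?_)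
  simp [sextic, wedge]
  ring

/-- Multiplication by H is linear over the base ring, so stability of the span need only be checked
on the basis. -/
theorem mul_of_forall_basis {H : MvPolynomial PluckerIndex ℂ}
    (hH : ∀ i, IsSpanned (H * moduleBasis i)) (hF : IsSpanned F) : IsSpanned (H * F) := by
  obtain ⟨c, hc⟩ := hF
  have h : ∀ s : Finset (Fin 5),
      IsSpanned (∑ i ∈ s, linearPullback jacobianMap (c i) * (H * moduleBasis i)) := by
    intro s
    induction s using Finset.induction_on with
    | empty => simpa using one.C_mul 0
    | insert i s hi ih =>
      rw [Finset.sum_insert hi]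
      exact ((hH i).mul_left _).add ih
  refine congr (h Finset.univ) ?_
  convert pluckerIdeal.mul_mem_left H hc using 1
  rw [mul_sub, Finset.mul_sum]
  congr 1
  exact Finset.sum_congr rfl fun i _ => by ring

theorem p12_mul (hF : IsSpanned F) : IsSpanned (X (idx 1 2) * F) := by
  refine mul_of_forall_basis (fun i => ?_) hF
  fin_cases i
  · simpa [moduleBasis] using p12
  · exact p12_sq
  · exact p12_mul_p13
  · exact p12_mul_p23
  · simpa [moduleBasis, sq] using p12_mul_p13_sq

theorem p13_mul (hF : IsSpanned F) : IsSpanned (X (idx 1 3) * F) := by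
  refine mul_of_forall_basis (fun i => ?_) hF
  fin_cases i
  · simpa [moduleBasis] using p13
  · simpa [moduleBasis, mul_comm] using p12_mul_p13
  · exact p13_sq
  · exact p13_mul_p23
  · simpa [moduleBasis, sq] using p13_cube

theorem p23_mul (hF : IsSpanned F) : IsSpanned (X (idx 2 3) * F) := by
  refine mul_of_forall_basis (fun i => ?_) hF
  fin_cases i
  · simpa [moduleBasis] using p23
  · simpa [moduleBasis, mul_comm] using p12_mul_p23
  · simpa [moduleBasis, mul_comm] using p13_mul_p23
  · exact p23_sq
  · simpa [moduleBasis, sq] using p23_mul_p13_sq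

theorem X_mul (hF : IsSpanned F) (p : PluckerIndex) : IsSpanned (X p * F) := by
  have h : ∀ {G : MvPolynomial PluckerIndex ℂ}, IsSpanned (G * F) → X p = G → IsSpanned (X p * F) :=
    fun hG h => by rwa [h]
  obtain ⟨⟨i, j⟩, hij⟩ := p
  fin_cases i <;> fin_cases j <;> first | exact absurd hij (by decide) | skip
  · exact hF.sextic_mul 0
  · exact hF.sextic_mul 1
  · refine h (G := sextic X 2 - C 2 * X (idx 1 2)) ?_ (by
      simp only [sextic, map_ofNat]
      exact (add_sub_cancel_right _ _).symm)
    rw [sub_mul, mul_assoc]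
    exact (hF.sextic_mul 2).sub (hF.p12_mul.C_mul 2)
  · refine h (G := sextic X 3 - C 8 * X (idx 1 3)) ?_ (by
      simp only [sextic, map_ofNat]
      exact (add_sub_cancel_right _ _).symm)
    rw [sub_mul, mul_assoc]
    exact (hF.sextic_mul 3).sub (hF.p13_mul.C_mul 8)
  · exact hF.p12_mul
  · exact hF.p13_mul
  · refine h (G := sextic X 4 - C 2 * X (idx 2 3)) ?_ (by
      simp only [sextic, map_ofNat]
      exact (add_sub_cancel_right _ _).symm)
    rw [sub_mul, mul_assoc]
    exact (hF.sextic_mul 4).sub (hF.p23_mul.C_mul 2)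
  · exact hF.p23_mul
  · exact hF.sextic_mul 5
  · exact hF.sextic_mul 6

end IsSpanned

/-- The span contains 1 and is stable under multiplication by every Plücker coordinate. -/
theorem isSpanned (F : MvPolynomial PluckerIndex ℂ) : IsSpanned F := by
  induction F using MvPolynomial.induction_on with
  | C c => simpa using IsSpanned.one.C_mul c
  | add F G hF hG => exact hF.add hG
  | mul_X F p hF => rw [mul_comm]; exact hF.X_mul p

theorem restrictToLine_linearPullback {σ τ : Type} [Fintype σ] [DecidableEq σ]
    (q : (σ → ℂ) →ₗ[ℂ] (τ → ℂ)) (v : σ → ℂ) (F : MvPolynomial τ ℂ) :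
    restrictToLine v (linearPullback q F) = restrictToLine (q v) F := by
  refine Polynomial.funext fun c => ?_
  rw [eval_restrictToLine, eval_restrictToLine, eval_linearPullback, map_smul]

/-- The elements of `moduleBasis` generate the homogeneous coordinate ring, in every degree. -/
theorem exists_sub_mem_pluckerIdeal {F : MvPolynomial PluckerIndex ℂ} {d : ℕ}
    (hF : F.IsHomogeneous d) : ∃ c : Fin 5 → MvPolynomial (Fin 7) ℂ,
      (∀ i, basisDegree i ≤ d → (c i).IsHomogeneous (d - basisDegree i)) ∧
      (∀ i, d < basisDegree i → c i = 0) ∧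
      F - ∑ i, linearPullback jacobianMap (c i) * moduleBasis i ∈ pluckerIdeal := by
  obtain ⟨c, hc⟩ := isSpanned F
  -- The guard is essential: for `basisDegree i > d` truncated subtraction would select the constant
  -- term of the coefficient instead of 0.
  refine ⟨fun i => if basisDegree i ≤ d then homogeneousComponent (d - basisDegree i) (c i) else 0,
    fun i hi => ?_, fun i hi => if_neg (not_le.mpr hi), ?_⟩
  · simp only [if_pos hi]
    exact homogeneousComponent_isHomogeneous _ _
  · have := homogeneousComponent_mem_pluckerIdeal hc d
    rw [map_sub, homogeneousComponent_of_mem hF, if_pos rfl, map_sum] at this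
    convert this using 3 with i
    -- The degree-d component of each product is computed pointwise, as the coefficient of T ^ d
    -- after restriction to the line through v.
    refine MvPolynomial.funext fun v => ?_
    rw [← coeff_restrictToLine, map_mul, map_mul,
      restrictToLine_of_isHomogeneous v (moduleBasis_isHomogeneous i), ← mul_assoc,
      Polynomial.coeff_mul_X_pow', restrictToLine_linearPullback, eval_linearPullback]
    split_ifs with h
    · rw [Polynomial.coeff_mul_C, coeff_restrictToLine]
      simp only [if_pos h]
    · simp [h]

/-- A polynomial whose nonvanishing ensures that the fibre of `jac` has five points. -/
def branchForm : MvPolynomial (Fin 7) ℂ := branch fun i => C (sexticFactor i)⁻¹ * X i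

theorem eval_branchForm (w : Fin 7 → ℂ) :
    eval w branchForm = branch fun i => (sexticFactor i)⁻¹ * w i := by
  rw [branchForm, map_branch]
  simp

theorem exists_eval_branchForm_ne_zero : ∃ w, eval w branchForm ≠ 0 := by
  refine ⟨fun i => sexticFactor i * (![1, 0, 0, 0, 0, 8, 0] : Fin 7 → ℂ) i, ?_⟩
  rw [eval_branchForm]
  convert branch_ne_zero using 2
  funext i
  rw [inv_mul_cancel_left₀ (sexticFactor_ne_zero i)]

/-- The elements of `moduleBasis` are linearly independent. -/
theorem eq_zero_of_sum_mem_pluckerIdeal {c : Fin 5 → MvPolynomial (Fin 7) ℂ}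
    (hc : ∑ i, linearPullback jacobianMap (c i) * moduleBasis i ∈ pluckerIdeal) : c = 0 := by
  have h0 : branchForm ≠ 0 := by
    intro h
    obtain ⟨w, hw⟩ := exists_eval_branchForm_ne_zero
    exact hw (by rw [h, map_zero])
  funext i
  -- The product vanishes at every y: either `branchForm` does, or the five basis functions are
  -- independent on the solutions over y and all coefficients vanish there.
  refine (mul_eq_zero.mp (MvPolynomial.funext fun y => ?_ : branchForm * c i = 0)).resolve_left h0
  rw [map_mul, map_zero, mul_eq_zero, or_iff_not_imp_left]
  intro hy
  rw [eval_branchForm] at hy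
  have key := eq_zero_of_forall_solutions hy (α := fun i => eval y (c i)) ?_
  · exact congrFun key i
  · rintro p ⟨⟨a, b, rfl⟩, hp⟩
    have h := mem_pluckerIdeal_iff.mp hc a b
    rw [map_sum] at h
    simp only [map_mul, eval_linearPullback, jacobianMap_eq_iff.mpr hp] at h
    rw [← h]
    simp [Fin.sum_univ_five, moduleBasis]

end CoordinateRing

/-! ### Binary forms, pencils of quartics and their Plücker coordinates -/

section BinaryForms

open MvPolynomial

/-- The binary form of degree `d` with given coefficients. -/
def binaryForm (d : ℕ) (c : Fin (d + 1) → ℂ) : MvPolynomial (Fin 2) ℂ :=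
  ∑ k : Fin (d + 1), monomial (Finsupp.single 0 (d - (k : ℕ)) + Finsupp.single 1 (k : ℕ)) (c k)

theorem binaryForm_eq_sum (d : ℕ) (c : Fin (d + 1) → ℂ) :
    binaryForm d c = ∑ k : Fin (d + 1), C (c k) * (X 0 ^ (d - (k : ℕ)) * X 1 ^ (k : ℕ)) := by
  refine Finset.sum_congr rfl fun k _ => ?_
  rw [X_pow_eq_monomial, X_pow_eq_monomial, monomial_mul, C_mul_monomial, one_mul, mul_one]

theorem exponent_injective (d : ℕ) : Function.Injective fun k : Fin (d + 1) =>
    (Finsupp.single 0 (d - (k : ℕ)) + Finsupp.single 1 (k : ℕ) : Fin 2 →₀ ℕ) := by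
  intro k l h
  have := DFunLike.congr_fun h 1
  simpa [Fin.ext_iff] using this

theorem formCoeff_binaryForm (d : ℕ) (c : Fin (d + 1) → ℂ) : formCoeff d (binaryForm d c) = c := by
  funext k
  rw [formCoeff, binaryForm, coeff_sum, Finset.sum_eq_single k]
  · rw [coeff_monomial, if_pos rfl]
  · intro l _ hl
    rw [coeff_monomial, if_neg fun h => hl (exponent_injective d h)]
  · simp

theorem binaryForm_isHomogeneous (d : ℕ) (c : Fin (d + 1) → ℂ) :
    (binaryForm d c).IsHomogeneous d := by
  rw [binaryForm_eq_sum]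
  refine IsHomogeneous.sum _ _ _ fun k _ => ?_
  have := (isHomogeneous_C (Fin 2) (c k)).mul
    ((isHomogeneous_X_pow (R := ℂ) (0 : Fin 2) (d - k)).mul (isHomogeneous_X_pow (1 : Fin 2) k))
  rwa [zero_add, Nat.sub_add_cancel (Nat.le_of_lt_succ k.2)] at this

theorem binaryForm_formCoeff {d : ℕ} {F : MvPolynomial (Fin 2) ℂ} (hF : F.IsHomogeneous d) :
    binaryForm d (formCoeff d F) = F := by
  ext m
  by_cases hm : m 0 + m 1 = d
  · have hm' : m = Finsupp.single 0 (d - m 1) + Finsupp.single 1 (m 1) := by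
      ext i
      fin_cases i
      · simp
        omega
      · simp
    have := congrFun (formCoeff_binaryForm d (formCoeff d F)) ⟨m 1, by omega⟩
    simp only [formCoeff] at this
    rwa [← hm'] at this
  · have hdeg : m.degree ≠ d := by
      rwa [Finsupp.degree_eq_sum, Fin.sum_univ_two]
    rw [hF.coeff_eq_zero hdeg, (binaryForm_isHomogeneous d _).coeff_eq_zero hdeg]

/-- The binary quartic with coordinates `a`. -/
def quartic (a : Fin 5 → ℂ) : MvPolynomial (Fin 2) ℂ :=
  binaryForm 4 fun i => (Nat.choose 4 i : ℂ) * a i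

theorem choose_four_ne_zero (i : Fin 5) : (Nat.choose 4 i : ℂ) ≠ 0 :=
  Nat.cast_ne_zero.mpr (Nat.choose_pos (Nat.le_of_lt_succ i.2)).ne'

theorem quartic_isHomogeneous (a : Fin 5 → ℂ) : (quartic a).IsHomogeneous 4 :=
  binaryForm_isHomogeneous 4 _

theorem quarticCoord_quartic (a : Fin 5 → ℂ) : quarticCoord (quartic a) = a := by
  funext i
  rw [quarticCoord, quartic, formCoeff_binaryForm, mul_div_cancel_left₀ _ (choose_four_ne_zero i)]

theorem quartic_quarticCoord {f : MvPolynomial (Fin 2) ℂ} (hf : f.IsHomogeneous 4) :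
    quartic (quarticCoord f) = f := by
  conv_rhs => rw [← binaryForm_formCoeff hf]
  rw [quartic]
  congr 1
  funext i
  rw [quarticCoord, mul_div_cancel₀ _ (choose_four_ne_zero i)]

theorem quarticCoord_combination (s t : ℂ) (f g : MvPolynomial (Fin 2) ℂ) :
    quarticCoord (s • f + t • g) = s • quarticCoord f + t • quarticCoord g := by
  funext i
  simp only [quarticCoord, formCoeff, coeff_add, coeff_smul, smul_eq_mul, Pi.add_apply,
    Pi.smul_apply]
  ring

theorem quartic_combination (s t : ℂ) (a b : Fin 5 → ℂ) :
    quartic (s • a + t • b) = s • quartic a + t • quartic b := by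
  have h : (s • quartic a + t • quartic b).IsHomogeneous 4 :=
    add_mem ((homogeneousSubmodule (Fin 2) ℂ 4).smul_mem s (quartic_isHomogeneous a))
      ((homogeneousSubmodule (Fin 2) ℂ 4).smul_mem t (quartic_isHomogeneous b))
  rw [← quartic_quarticCoord h, quarticCoord_combination, quarticCoord_quartic,
    quarticCoord_quartic]

theorem plucker_eq_wedge (f g : MvPolynomial (Fin 2) ℂ) :
    plucker f g = wedge (quarticCoord f) (quarticCoord g) :=
  rfl

/-- The explicit expansion of the determinant; it is the origin of `sextic` and of the factors 16
and 48. -/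
theorem jacobian_quartic (a b : Fin 5 → ℂ) :
    jacobian (quartic a) (quartic b) = binaryForm 6 (jacobianMap (wedge a b)) := by
  rw [jacobian, Matrix.det_fin_two, quartic, quartic, binaryForm_eq_sum, binaryForm_eq_sum,
    binaryForm_eq_sum]
  have hj : ∀ i, jacobianMap (wedge a b) i = sexticFactor i * sextic (wedge a b) i := fun i => rfl
  have hC : ∀ n : ℕ, [n.AtLeastTwo] →
      (C (OfNat.ofNat n) : MvPolynomial (Fin 2) ℂ) = OfNat.ofNat n := fun n _ => map_ofNat C n
  simp [hj, Fin.sum_univ_succ, sexticFactor, sextic, wedge, pderiv_X, Nat.choose, hC]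
  ring

theorem formCoeff_jacobian {f g : MvPolynomial (Fin 2) ℂ} (hf : f.IsHomogeneous 4)
    (hg : g.IsHomogeneous 4) : formCoeff 6 (jacobian f g) = jacobianMap (plucker f g) := by
  conv_lhs => rw [← quartic_quarticCoord hf, ← quartic_quarticCoord hg]
  rw [jacobian_quartic, formCoeff_binaryForm, plucker_eq_wedge]

end BinaryForms

/-! ### Decomposable vectors and the Plücker relations -/

section Wedge

open MvPolynomial

/-- The alternating extension of a family indexed by the pairs `i < j`. -/
def altExtension {R : Type*} [CommRing R] (v : PluckerIndex → R) (i j : Fin 5) : R :=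
  if h : i < j then v ⟨(i, j), h⟩ else if h : j < i then -v ⟨(j, i), h⟩ else 0

theorem altExtension_apply {R : Type*} [CommRing R] (v : PluckerIndex → R) (p : PluckerIndex) :
    altExtension v p.1.1 p.1.2 = v p :=
  dif_pos p.2

theorem altExtension_wedge {R : Type*} [CommRing R] (a b : Fin 5 → R) (i j : Fin 5) :
    altExtension (wedge a b) i j = a i * b j - a j * b i := by
  rw [altExtension]
  split_ifs with h h'
  · rfl
  · rw [wedge]
    ring
  · obtain rfl : i = j := le_antisymm (not_lt.mp h') (not_lt.mp h)
    ring

theorem altExtension_smul {R : Type*} [CommRing R] (c : R) (v : PluckerIndex → R) (i j : Fin 5) :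
    altExtension (c • v) i j = c * altExtension v i j := by
  rw [altExtension, altExtension]
  split_ifs <;> simp

theorem map_altExtension {R S : Type*} [CommRing R] [CommRing S] (f : R →+* S)
    (v : PluckerIndex → R) (i j : Fin 5) :
    f (altExtension v i j) = altExtension (fun p => f (v p)) i j := by
  rw [altExtension, altExtension]
  split_ifs <;> simp

theorem pluckerRelation_mem (i j k l : Fin 5) :
    (altExtension X i j * altExtension X k l - altExtension X i k * altExtension X j l +
      altExtension X i l * altExtension X j k : MvPolynomial PluckerIndex ℂ) ∈ pluckerIdeal := by
  refine mem_pluckerIdeal_iff.mpr fun a b => ?_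
  simp only [map_add, map_sub, map_mul, map_altExtension, eval_X]
  change altExtension (wedge a b) i j * altExtension (wedge a b) k l - altExtension (wedge a b) i k *
    altExtension (wedge a b) j l + altExtension (wedge a b) i l * altExtension (wedge a b) j k = 0
  simp only [altExtension_wedge]
  ring

/-- Once some v_ij is nonzero, the three-term relations express every v_kl through the rows i and j;
those rows, one divided by v_ij, are the two vectors. -/
theorem exists_eq_wedge {v : PluckerIndex → ℂ} (hv : ∀ F ∈ pluckerIdeal, eval v F = 0) :
    ∃ a b, v = wedge a b := by
  by_cases h0 : v = 0
  · exact ⟨0, 0, by rw [h0]; funext p; simp [wedge]⟩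
  obtain ⟨p, hp⟩ := Function.ne_iff.mp h0
  obtain ⟨⟨i, j⟩, hij⟩ := p
  have hV : altExtension v i j ≠ 0 := by
    have := altExtension_apply v ⟨(i, j), hij⟩
    rwa [this]
  have hrel : ∀ k l, altExtension v i j * altExtension v k l - altExtension v i k *
      altExtension v j l + altExtension v i l * altExtension v j k = 0 := by
    intro k l
    have := hv _ (pluckerRelation_mem i j k l)
    simpa only [map_add, map_sub, map_mul, map_altExtension, eval_X] using this
  refine ⟨fun k => altExtension v i k, fun k => altExtension v j k / altExtension v i j, ?_⟩
  funext p
  rw [wedge, ← altExtension_apply v p]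
  field_simp
  linear_combination hrel p.1.1 p.1.2

theorem wedge_combination {R : Type*} [CommRing R] (a b : Fin 5 → R) (s t u v : R) :
    wedge (s • a + t • b) (u • a + v • b) = (s * v - t * u) • wedge a b := by
  funext p
  simp only [wedge, Pi.add_apply, Pi.smul_apply, smul_eq_mul]
  ring

theorem wedge_ne_zero_iff {a b : Fin 5 → ℂ} : wedge a b ≠ 0 ↔ LinearIndependent ℂ ![a, b] := by
  rw [LinearIndependent.pair_iff]
  constructor
  · intro h s t hst
    have h1 := wedge_combination a b s t 0 1
    have h2 := wedge_combination a b s t 1 0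
    rw [hst] at h1 h2
    have h0 : ∀ c : Fin 5 → ℂ, wedge 0 c = 0 := fun c => by funext p; simp [wedge]
    rw [h0, eq_comm, smul_eq_zero] at h1 h2
    exact ⟨by simpa using h1.resolve_right h, by simpa using h2.resolve_right h⟩
  · intro h h0
    have hw : ∀ i j, a i * b j - a j * b i = 0 := fun i j => by
      rw [← altExtension_wedge, h0]
      simp [altExtension]
    have ha : a = 0 := by
      funext i
      have := (h (b i) (-a i) (by
        funext j
        simp only [Pi.add_apply, Pi.smul_apply, smul_eq_mul, Pi.zero_apply]
        linear_combination -hw i j)).2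
      simpa using this
    have := (h 1 0 (by rw [ha]; simp)).1
    exact one_ne_zero this

/-- Cramer's rule: a' and b' satisfy x_k p'_ij = x_j p'_ik - x_i p'_jk. Replacing p'_ik and p'_jk by
c p_ik and c p_jk makes the right side a combination of a_k and b_k with coefficients independent of
k. -/
theorem span_le_of_wedge_eq_smul {a b a' b' : Fin 5 → ℂ} {c : ℂ}
    (h : wedge a' b' = c • wedge a b) (h0 : wedge a' b' ≠ 0) :
    ∀ x ∈ ({a', b'} : Set (Fin 5 → ℂ)), ∃ s t : ℂ, x = s • a + t • b := by
  obtain ⟨⟨⟨i, j⟩, hij⟩, hp⟩ := Function.ne_iff.mp h0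
  have hp : a' i * b' j - a' j * b' i ≠ 0 := hp
  have hw : ∀ k l, a' k * b' l - a' l * b' k = c * (a k * b l - a l * b k) := fun k l => by
    rw [← altExtension_wedge, ← altExtension_wedge, h, altExtension_smul]
  suffices H : ∀ x : Fin 5 → ℂ, (∀ k, x k * (a' i * b' j - a' j * b' i) =
      x j * (a' i * b' k - a' k * b' i) - x i * (a' j * b' k - a' k * b' j)) →
      ∃ s t : ℂ, x = s • a + t • b by
    rintro x (rfl | rfl)
    · exact H _ fun k => by ring
    · exact H _ fun k => by ring
  intro x hx
  refine ⟨-(c * (x j * b i - x i * b j)) / (a' i * b' j - a' j * b' i),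
    c * (x j * a i - x i * a j) / (a' i * b' j - a' j * b' i), ?_⟩
  funext k
  simp only [Pi.add_apply, Pi.smul_apply, smul_eq_mul]
  field_simp
  rw [hx k, hw i k, hw j k]
  ring

end Wedge

/-! ### Pencils are determined by their Plücker coordinates -/

section Pencils

open MvPolynomial

theorem plucker_ne_zero_iff {f g : MvPolynomial (Fin 2) ℂ} (hf : f.IsHomogeneous 4)
    (hg : g.IsHomogeneous 4) : plucker f g ≠ 0 ↔ LinearIndependent ℂ ![f, g] := by
  rw [plucker_eq_wedge, wedge_ne_zero_iff, LinearIndependent.pair_iff, LinearIndependent.pair_iff]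
  refine forall₂_congr fun s t => ?_
  refine imp_congr ⟨fun h => ?_, fun h => ?_⟩ Iff.rfl
  · have := quartic_combination s t (quarticCoord f) (quarticCoord g)
    rw [h, quartic_quarticCoord hf, quartic_quarticCoord hg] at this
    rw [← this]
    simp [quartic, binaryForm]
  · rw [← quarticCoord_combination, h]
    funext i
    simp [quarticCoord, formCoeff]

theorem exists_combination_of_mem_span {R M : Type*} [CommRing R] [AddCommGroup M] [Module R M]
    {f g x : M} (hx : x ∈ Submodule.span R {f, g}) : ∃ s t : R, x = s • f + t • g := by
  obtain ⟨s, t, h⟩ := Submodule.mem_span_pair.mp hx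
  exact ⟨s, t, h.symm⟩

theorem Pencil.isHomogeneous (W : Pencil) {f : MvPolynomial (Fin 2) ℂ} (hf : f ∈ W.1) :
    f.IsHomogeneous 4 :=
  W.2.1 hf

theorem Pencil.isHomogeneous_of_eq_span {W : Pencil} {f g : MvPolynomial (Fin 2) ℂ}
    (h : W.1 = Submodule.span ℂ {f, g}) : f.IsHomogeneous 4 ∧ g.IsHomogeneous 4 :=
  ⟨W.isHomogeneous (h ▸ Submodule.subset_span (by simp)),
    W.isHomogeneous (h ▸ Submodule.subset_span (by simp))⟩

theorem Pencil.plucker_ne_zero {W : Pencil} {f g : MvPolynomial (Fin 2) ℂ}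
    (h : W.1 = Submodule.span ℂ {f, g}) : plucker f g ≠ 0 := by
  obtain ⟨hf, hg⟩ := Pencil.isHomogeneous_of_eq_span h
  rw [plucker_ne_zero_iff hf hg, linearIndependent_iff_card_eq_finrank_span]
  rw [Set.finrank, Matrix.range_cons, Matrix.range_cons, Matrix.range_empty, Set.union_empty,
    Set.singleton_union, ← h, W.2.2, Fintype.card_fin]

theorem Pencil.exists_eq_span (W : Pencil) :
    ∃ f g, f.IsHomogeneous 4 ∧ g.IsHomogeneous 4 ∧ plucker f g ≠ 0 ∧
      W.1 = Submodule.span ℂ {f, g} := by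
  have : Module.Finite ℂ W.1 := Module.finite_of_finrank_eq_succ W.2.2
  have e := Module.finBasisOfFinrankEq ℂ W.1 W.2.2
  have hspan : W.1 = Submodule.span ℂ {(e 0 : MvPolynomial (Fin 2) ℂ), (e 1).1} := by
    have h := congrArg (Submodule.map W.1.subtype) e.span_eq
    rw [Submodule.map_span, Submodule.map_top, Submodule.range_subtype] at h
    refine h.symm.trans (congrArg _ ?_)
    ext x
    simp [eq_comm]
  obtain ⟨h0, h1⟩ := Pencil.isHomogeneous_of_eq_span hspan
  exact ⟨e 0, e 1, h0, h1, Pencil.plucker_ne_zero hspan, hspan⟩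

/-- The pencil spanned by two binary quartics. -/
def Pencil.ofWedge (a b : Fin 5 → ℂ) (h : wedge a b ≠ 0) : Pencil :=
  ⟨Submodule.span ℂ {quartic a, quartic b}, by
    constructor
    · rw [Submodule.span_le]
      rintro x (rfl | rfl)
      · exact quartic_isHomogeneous a
      · exact quartic_isHomogeneous b
    · have hp : plucker (quartic a) (quartic b) ≠ 0 := by
        rwa [plucker_eq_wedge, quarticCoord_quartic, quarticCoord_quartic]
      rw [plucker_ne_zero_iff (quartic_isHomogeneous a) (quartic_isHomogeneous b),
        linearIndependent_iff_card_eq_finrank_span] at hp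
      rw [Set.finrank, Matrix.range_cons, Matrix.range_cons, Matrix.range_empty, Set.union_empty,
        Set.singleton_union, Fintype.card_fin] at hp
      exact hp.symm⟩

theorem Pencil.exists_plucker_eq_smul {W : Pencil} {f g f' g' : MvPolynomial (Fin 2) ℂ}
    (h : W.1 = Submodule.span ℂ {f, g}) (h' : W.1 = Submodule.span ℂ {f', g'}) :
    ∃ c : ℂ, plucker f' g' = c • plucker f g := by
  obtain ⟨s, t, rfl⟩ := exists_combination_of_mem_span (R := ℂ) (f := f) (g := g) (x := f')
    (h ▸ h' ▸ Submodule.subset_span (by simp))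
  obtain ⟨u, v, rfl⟩ := exists_combination_of_mem_span (R := ℂ) (f := f) (g := g) (x := g')
    (h ▸ h' ▸ Submodule.subset_span (by simp))
  refine ⟨s * v - t * u, ?_⟩
  rw [plucker_eq_wedge, quarticCoord_combination, quarticCoord_combination, wedge_combination,
    plucker_eq_wedge]

theorem Pencil.le_of_plucker_eq_smul {W W' : Pencil} {f g f' g' : MvPolynomial (Fin 2) ℂ}
    (h : W.1 = Submodule.span ℂ {f, g}) (h' : W'.1 = Submodule.span ℂ {f', g'}) {c : ℂ}
    (hc : plucker f' g' = c • plucker f g) : W'.1 ≤ W.1 := by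
  obtain ⟨hf, hg⟩ := Pencil.isHomogeneous_of_eq_span h
  obtain ⟨hf', hg'⟩ := Pencil.isHomogeneous_of_eq_span h'
  have key := span_le_of_wedge_eq_smul hc (Pencil.plucker_ne_zero h')
  have hmem : ∀ {x : MvPolynomial (Fin 2) ℂ}, x.IsHomogeneous 4 →
      quarticCoord x ∈ ({quarticCoord f', quarticCoord g'} : Set (Fin 5 → ℂ)) →
      x ∈ Submodule.span ℂ {f, g} := by
    intro x hx hm
    obtain ⟨s, t, hst⟩ := key _ hm
    rw [← quartic_quarticCoord hx, hst, quartic_combination, quartic_quarticCoord hf,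
      quartic_quarticCoord hg]
    exact Submodule.mem_span_pair.mpr ⟨s, t, rfl⟩
  rw [h, h', Submodule.span_le]
  rintro x (rfl | rfl)
  · exact hmem hf' (by simp)
  · exact hmem hg' (by simp)

theorem Pencil.eq_of_plucker_eq_smul {W W' : Pencil} {f g f' g' : MvPolynomial (Fin 2) ℂ}
    (h : W.1 = Submodule.span ℂ {f, g}) (h' : W'.1 = Submodule.span ℂ {f', g'}) {c : ℂ}
    (hc : plucker f' g' = c • plucker f g) : W = W' := by
  have hc0 : c ≠ 0 := by
    rintro rfl
    exact Pencil.plucker_ne_zero h' (by rw [hc, zero_smul])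
  refine Subtype.ext (le_antisymm (Pencil.le_of_plucker_eq_smul h' h (c := c⁻¹) ?_)
    (Pencil.le_of_plucker_eq_smul h h' hc))
  rw [hc, smul_smul, inv_mul_cancel₀ hc0, one_smul]

end Pencils

/-! ### The Plücker variety and its homogeneous ideal -/

section PluckerVariety

open MvPolynomial

/-- The set of Plücker points of pencils. -/
def pluckerPoints : Set (ProjSpace PluckerIndex) :=
  {x | ∃ (W : Pencil) (f g : MvPolynomial (Fin 2) ℂ) (h : plucker f g ≠ 0),
      W.1 = Submodule.span ℂ {f, g} ∧ x = point (plucker f g) h}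

theorem point_wedge_mem_pluckerPoints {a b : Fin 5 → ℂ} (h : wedge a b ≠ 0) :
    point (wedge a b) h ∈ pluckerPoints := by
  have hp : plucker (quartic a) (quartic b) = wedge a b := by
    rw [plucker_eq_wedge, quarticCoord_quartic, quarticCoord_quartic]
  refine ⟨Pencil.ofWedge a b h, quartic a, quartic b, by rwa [hp], rfl, ?_⟩
  simp only [hp]

theorem mem_vanishingIdeal_pluckerPoints {F : MvPolynomial PluckerIndex ℂ} :
    F ∈ ProjectiveSpectrum.vanishingIdeal (𝒜 := homogeneousSubmodule PluckerIndex ℂ)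
      pluckerPoints ↔ F ∈ pluckerIdeal := by
  refine (ProjectiveSpectrum.mem_vanishingIdeal _ _).trans ⟨fun h => ?_, ?_⟩
  · refine mem_pluckerIdeal_iff.mpr fun a b => ?_
    by_cases h0 : wedge a b = 0
    -- A zero wedge is not a point, so vanishing at the origin is read off from the line through any
    -- actual Plücker point.
    · have h1 : wedge (Pi.single 0 1) (Pi.single 1 1) ≠ (0 : PluckerIndex → ℂ) := by
        intro h
        have := congrFun h (idx 0 1)
        simp [wedge] at this
      have := restrictToLine_eq_zero_iff.mp (mem_point_iff.mp (h _
        (point_wedge_mem_pluckerPoints h1))) 0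
      rwa [zero_smul, ← h0] at this
    · exact eval_eq_zero_of_mem_point (h _ (point_wedge_mem_pluckerPoints h0))
  · rintro h x ⟨W, f, g, hp, -, rfl⟩
    refine mem_point_iff.mpr (restrictToLine_eq_zero_iff.mpr fun c => ?_)
    have := mem_pluckerIdeal_iff.mp h (c • quarticCoord f) (quarticCoord g)
    rw [← this, plucker_eq_wedge]
    congr 2
    funext p
    simp only [wedge, Pi.smul_apply, smul_eq_mul]
    ring

theorem coe_pluckerVariety :
    (pluckerVariety : Set (ProjSpace PluckerIndex)) = closure pluckerPoints :=
  rfl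

theorem vanishingIdeal_pluckerVariety :
    (ProjectiveSpectrum.vanishingIdeal (𝒜 := homogeneousSubmodule PluckerIndex ℂ)
      (pluckerVariety : Set (ProjSpace PluckerIndex))).toIdeal = pluckerIdeal := by
  ext F
  refine Iff.trans ?_ mem_vanishingIdeal_pluckerPoints
  have h := ProjectiveSpectrum.vanishingIdeal_closure
    (𝒜 := homogeneousSubmodule PluckerIndex ℂ) pluckerPoints
  rw [← h]
  rfl

theorem mem_pluckerVariety_iff {x : ProjSpace PluckerIndex} :
    x ∈ pluckerVariety ↔ pluckerIdeal ≤ x.asHomogeneousIdeal.toIdeal := by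
  have h1 : x ∈ pluckerVariety ↔ x ∈ ProjectiveSpectrum.zeroLocus
      (homogeneousSubmodule PluckerIndex ℂ) (ProjectiveSpectrum.vanishingIdeal
        (𝒜 := homogeneousSubmodule PluckerIndex ℂ) pluckerPoints : Set _) :=
    iff_of_eq (congrArg (x ∈ ·) (ProjectiveSpectrum.zeroLocus_vanishingIdeal_eq_closure
      (𝒜 := homogeneousSubmodule PluckerIndex ℂ) pluckerPoints).symm)
  rw [h1]
  constructor
  · intro h F hF
    exact h (mem_vanishingIdeal_pluckerPoints.mpr hF)
  · intro h F hF
    exact h (mem_vanishingIdeal_pluckerPoints.mp hF)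

end PluckerVariety

/-! ### The Hilbert polynomial of the Plücker variety -/

section HilbertPolynomial

open MvPolynomial

theorem finite_homogeneousSubmodule (σ : Type) [Finite σ] (d : ℕ) :
    Module.Finite ℂ (homogeneousSubmodule σ ℂ d) :=
  Module.Finite.iff_fg.mpr (homogeneousSubmodule_fg σ ℂ d)

/-- Monomials of degree d are multisets of size d, counted by stars and bars. -/
theorem finrank_homogeneousSubmodule (n d : ℕ) :
    Module.finrank ℂ (homogeneousSubmodule (Fin (n + 1)) ℂ d) = (d + n).choose n := by
  have e : {m : Fin (n + 1) →₀ ℕ | m.degree = d} ≃ Sym (Fin (n + 1)) d :=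
    (Sym.equivNatSum (Fin (n + 1)) d).symm
  have : Fintype {m : Fin (n + 1) →₀ ℕ | m.degree = d} := Fintype.ofEquiv _ e.symm
  rw [(LinearEquiv.ofEq _ _ (homogeneousSubmodule_eq_finsupp_supported (Fin (n + 1)) ℂ d)).finrank_eq,
    (AddMonoidAlgebra.supportedEquivFinsupp _).finrank_eq, Module.finrank_finsupp_self,
    Fintype.card_congr e, Sym.card_sym_eq_choose, Fintype.card_fin,
    show n + 1 + d - 1 = d + n by omega, Nat.choose_symm_of_eq_add rfl]

/-- The homogeneous ideal of the Plücker variety, in degree `d`. -/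
def pluckerIdealDegree (d : ℕ) : Submodule ℂ (homogeneousSubmodule PluckerIndex ℂ d) :=
  Submodule.comap (homogeneousSubmodule PluckerIndex ℂ d).subtype
    (pluckerIdeal.restrictScalars ℂ)

theorem mem_pluckerIdealDegree {d : ℕ} {F : homogeneousSubmodule PluckerIndex ℂ d} :
    F ∈ pluckerIdealDegree d ↔ F.1 ∈ pluckerIdeal :=
  Iff.rfl

theorem combination_mem {d : ℕ} (hd : 2 ≤ d)
    (c : Π i, homogeneousSubmodule (Fin 7) ℂ (d - basisDegree i)) :
    ∑ i, linearPullback jacobianMap (c i).1 * moduleBasis i ∈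
      homogeneousSubmodule PluckerIndex ℂ d := by
  refine sum_mem fun i _ => ?_
  have := (linearPullback_isHomogeneous jacobianMap (c i).2).mul (moduleBasis_isHomogeneous i)
  have hi : basisDegree i ≤ 2 := by fin_cases i <;> decide
  rwa [Nat.sub_add_cancel (hi.trans hd)] at this

/-- Linear combinations of `moduleBasis`, in degree `d`. -/
def combination {d : ℕ} (hd : 2 ≤ d) :
    (Π i, homogeneousSubmodule (Fin 7) ℂ (d - basisDegree i)) →ₗ[ℂ]
      homogeneousSubmodule PluckerIndex ℂ d where
  toFun c := ⟨_, combination_mem hd c⟩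
  map_add' c c' := Subtype.ext (by
    simp only [Pi.add_apply, Submodule.coe_add, map_add, add_mul, Finset.sum_add_distrib])
  map_smul' r c := Subtype.ext (by
    simp only [Pi.smul_apply, Submodule.coe_smul, smul_eq_C_mul, map_mul, linearPullback_C,
      Finset.mul_sum, mul_assoc, RingHom.id_apply])

theorem coe_combination {d : ℕ} (hd : 2 ≤ d)
    (c : Π i, homogeneousSubmodule (Fin 7) ℂ (d - basisDegree i)) :
    (combination hd c : MvPolynomial PluckerIndex ℂ) =
      ∑ i, linearPullback jacobianMap (c i).1 * moduleBasis i :=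
  rfl

/-- This is freeness of the coordinate ring in a single degree. For d ≥ 2 no subtraction `d -
basisDegree i` is truncated. -/
theorem mkQ_combination_bijective {d : ℕ} (hd : 2 ≤ d) :
    Function.Bijective ((pluckerIdealDegree d).mkQ ∘ₗ combination hd) := by
  constructor
  · rw [← LinearMap.ker_eq_bot, LinearMap.ker_eq_bot']
    intro c hc
    rw [LinearMap.comp_apply, Submodule.mkQ_apply, Submodule.Quotient.mk_eq_zero,
      mem_pluckerIdealDegree, coe_combination] at hc
    have := eq_zero_of_sum_mem_pluckerIdeal hc
    funext i
    exact Subtype.ext (congrFun this i)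
  · intro y
    obtain ⟨⟨F, hF⟩, rfl⟩ := Submodule.mkQ_surjective _ y
    obtain ⟨c, hc, -, hFc⟩ := exists_sub_mem_pluckerIdeal hF
    have hi : ∀ i, basisDegree i ≤ 2 := fun i => by fin_cases i <;> decide
    refine ⟨fun i => ⟨c i, hc i ((hi i).trans hd)⟩, Eq.symm ?_⟩
    rw [LinearMap.comp_apply, Submodule.mkQ_apply, Submodule.mkQ_apply, Submodule.Quotient.eq]
    exact hFc

theorem finrank_quotient_pluckerIdealDegree {d : ℕ} (hd : 2 ≤ d) :
    Module.finrank ℂ (homogeneousSubmodule PluckerIndex ℂ d ⧸ pluckerIdealDegree d) =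
      ∑ i, (d - basisDegree i + 6).choose 6 := by
  have := fun i => finite_homogeneousSubmodule (Fin 7) (d - basisDegree i)
  rw [← (LinearEquiv.ofBijective _ (mkQ_combination_bijective hd)).finrank_eq,
    Module.finrank_pi_fintype]
  exact Finset.sum_congr rfl fun i _ => finrank_homogeneousSubmodule 6 _

theorem hilbertFunction_pluckerVariety {d : ℕ} (hd : 2 ≤ d) :
    hilbertFunction (pluckerVariety : Set (ProjSpace PluckerIndex)) d =
      ∑ i, (d - basisDegree i + 6).choose 6 := by
  rw [← finrank_quotient_pluckerIdealDegree hd, hilbertFunction, vanishingIdeal_pluckerVariety]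
  rfl

theorem hasProjectiveDegree_pluckerVariety :
    HasProjectiveDegree (pluckerVariety : Set (ProjSpace PluckerIndex)) 6 5 := by
  -- Each of the five basis elements contributes leading coefficient 1 / 6!, whatever its degree.
  have hcoeff : (∑ i, Polynomial.preHilbertPoly ℚ 6 (basisDegree i)).coeff 6 = 5 * (6 ! : ℚ)⁻¹ := by
    rw [Polynomial.finsetSum_coeff]
    simp [Polynomial.coeff_preHilbertPoly_self]
  have hdeg : (∑ i, Polynomial.preHilbertPoly ℚ 6 (basisDegree i)).natDegree = 6 := by
    refine le_antisymm (Polynomial.natDegree_sum_le_of_forall_le _ _ fun i _ =>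
      (Polynomial.natDegree_preHilbertPoly ℚ 6 _).le) (Polynomial.le_natDegree_of_ne_zero ?_)
    rw [hcoeff]
    positivity
  refine ⟨∑ i, Polynomial.preHilbertPoly ℚ 6 (basisDegree i), ?_, hdeg, ?_⟩
  · filter_upwards [Filter.eventually_ge_atTop 2] with d hd
    have hi : ∀ i, basisDegree i ≤ 2 := fun i => by fin_cases i <;> decide
    rw [hilbertFunction_pluckerVariety hd, Polynomial.eval_finsetSum, Nat.cast_sum]
    exact Finset.sum_congr rfl fun i _ =>
      (Polynomial.preHilbertPoly_eq_choose_sub_add ℚ 6 ((hi i).trans hd)).symm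
  · rw [Polynomial.leadingCoeff, hdeg, hcoeff, mul_assoc, inv_mul_cancel₀ (by positivity)]
    norm_num

end HilbertPolynomial

/-! ### The Grassmannian -/

section Integrality

open MvPolynomial

/-- A homogeneous prime ideal that does not contain every variable, as a point of projective space. -/
def pointOfPrime {σ : Type} (I : Ideal (MvPolynomial σ ℂ)) [hI : I.IsPrime]
    (hhom : ∀ F ∈ I, ∀ d, homogeneousComponent d F ∈ I) (k : σ) (hk : X k ∉ I) : ProjSpace σ :=
  show ProjectiveSpectrum (homogeneousSubmodule σ ℂ) from
  { asHomogeneousIdeal := ⟨I, fun d F hF => by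
      rw [coe_decompose]
      exact hhom F hF d⟩
    isPrime := hI
    not_irrelevant_le := fun hle => hk (hle (HomogeneousIdeal.mem_irrelevant_of_mem _ zero_lt_one
      (isHomogeneous_X ℂ k))) }

/-- The generic point of projective space. -/
def genericPointProjSpace (σ : Type) (k : σ) : ProjSpace σ :=
  pointOfPrime (⊥ : Ideal (MvPolynomial σ ℂ)) (fun F hF d => by
    rw [Ideal.mem_bot.mp hF, map_zero]
    exact zero_mem _) k (X_ne_zero k)

theorem isGenericPoint_genericPointProjSpace (σ : Type) (k : σ) :
    IsGenericPoint (genericPointProjSpace σ k) Set.univ := by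
  refine Set.eq_univ_of_forall fun x => mem_closure_iff_ideal_le.mpr fun F hF => ?_
  have hF : F ∈ (⊥ : Ideal (MvPolynomial σ ℂ)) := hF
  rw [Ideal.mem_bot.mp hF]
  exact zero_mem x.asHomogeneousIdeal

/-- The ring of a standard chart embeds into a localization of a polynomial ring. -/
instance isReduced_projSpace (σ : Type) : IsReduced (ProjSpace σ) := by
  let U : (ProjSpace σ).OpenCover := Scheme.Cover.mkOfCovers σ _ targetChart (fun x => by
    obtain ⟨k, hk⟩ := exists_mem_basicOpen_X x
    rw [← Proj.opensRange_awayι _ _ (X_mem_homogeneousSubmodule k) zero_lt_one] at hk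
    exact ⟨k, hk⟩) fun k => inferInstance
  have (k : σ) : _root_.IsReduced (HomogeneousLocalization.Away (homogeneousSubmodule σ ℂ)
      (X k : MvPolynomial σ ℂ)) := by
    refine ⟨fun x ⟨n, h⟩ => HomogeneousLocalization.val_injective _ ?_⟩
    have hx : IsNilpotent x.val := ⟨n, by
      rw [← HomogeneousLocalization.val_pow, h, HomogeneousLocalization.val_zero]⟩
    rw [hx.eq_zero, HomogeneousLocalization.val_zero]
  have (k : U.I₀) : IsReduced (U.X k) :=
    inferInstanceAs (IsReduced (Spec (.of <| HomogeneousLocalization.Away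
      (homogeneousSubmodule σ ℂ) (X (show σ from k) : MvPolynomial σ ℂ))))
  exact IsReduced.of_openCover _ U

theorem isIntegral_projSpace (σ : Type) (k : σ) : IsIntegral (ProjSpace σ) := by
  have h : IsIrreducible (Set.univ : Set (ProjSpace σ)) := by
    rw [← isGenericPoint_genericPointProjSpace σ k]
    exact isIrreducible_singleton.closure
  have : IrreducibleSpace (ProjSpace σ) :=
    { isPreirreducible_univ := h.isPreirreducible
      toNonempty := ⟨genericPointProjSpace σ k⟩ }
  exact isIntegral_of_irreducibleSpace_of_isReduced _

instance : IsIntegral (ProjSpace (Fin 7)) := isIntegral_projSpace _ 0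

theorem X_notMem_pluckerIdeal (p : PluckerIndex) : X p ∉ pluckerIdeal := by
  intro h
  have := mem_pluckerIdeal_iff.mp h (Pi.single p.1.1 1) (Pi.single p.1.2 1)
  simp [wedge, (ne_of_lt p.2).symm, (ne_of_lt p.2)] at this

/-- The generic point of the Plücker variety. -/
def genericPointPlucker : ProjSpace PluckerIndex :=
  pointOfPrime pluckerIdeal (fun _ => homogeneousComponent_mem_pluckerIdeal) (idx 0 1)
    (X_notMem_pluckerIdeal _)

theorem closure_genericPointPlucker :
    closure {genericPointPlucker} = (pluckerVariety : Set (ProjSpace PluckerIndex)) :=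
  Set.ext fun _ => mem_closure_iff_ideal_le.trans mem_pluckerVariety_iff.symm

instance isClosedImmersion_pluckerEmbedding : IsClosedImmersion pluckerEmbedding := by
  exact inferInstanceAs (IsClosedImmersion
    (Scheme.IdealSheafData.vanishingIdeal pluckerVariety).subschemeι)

theorem range_pluckerEmbedding :
    Set.range pluckerEmbedding = (pluckerVariety : Set (ProjSpace PluckerIndex)) := by
  refine (Scheme.IdealSheafData.range_subschemeι _).trans ?_
  rw [Scheme.IdealSheafData.coe_support_vanishingIdeal]

instance isReduced_Gr : IsReduced Gr := by
  have (U : (ProjSpace PluckerIndex).affineOpens) : IsReduced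
      ((Scheme.IdealSheafData.vanishingIdeal pluckerVariety).subschemeCover.openCover.X U) := by
    have : _root_.IsReduced (Γ(ProjSpace PluckerIndex, U) ⧸
        (Scheme.IdealSheafData.vanishingIdeal pluckerVariety).ideal U) := by
      rw [← Ideal.isRadical_iff_quotient_reduced, Scheme.IdealSheafData.vanishingIdeal_ideal]
      exact PrimeSpectrum.isRadical_vanishingIdeal _
    exact inferInstanceAs (IsReduced (Spec (.of (Γ(ProjSpace PluckerIndex, U) ⧸
        (Scheme.IdealSheafData.vanishingIdeal pluckerVariety).ideal U))))
  have (U : (Scheme.IdealSheafData.vanishingIdeal pluckerVariety).subschemeCover.openCover.I₀) :=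
    this U
  exact IsReduced.of_openCover _
    (Scheme.IdealSheafData.vanishingIdeal pluckerVariety).subschemeCover.openCover

theorem isGenericPoint_of_pluckerEmbedding_eq {x : Gr}
    (hx : pluckerEmbedding x = genericPointPlucker) : IsGenericPoint x Set.univ := by
  refine Set.eq_univ_of_forall fun y => ?_
  rw [pluckerEmbedding.isClosedEmbedding.isInducing.closure_eq_preimage_closure_image,
    Set.image_singleton, hx, closure_genericPointPlucker, ← range_pluckerEmbedding]
  exact ⟨y, rfl⟩

theorem exists_pluckerEmbedding_eq_genericPointPlucker :
    ∃ x : Gr, pluckerEmbedding x = genericPointPlucker := by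
  have : genericPointPlucker ∈ Set.range pluckerEmbedding := by
    rw [range_pluckerEmbedding, ← closure_genericPointPlucker]
    exact subset_closure rfl
  exact this

instance irreducibleSpace_Gr : IrreducibleSpace Gr := by
  obtain ⟨x, hx⟩ := exists_pluckerEmbedding_eq_genericPointPlucker
  have h : IsIrreducible (Set.univ : Set Gr) := by
    rw [← isGenericPoint_of_pluckerEmbedding_eq hx]
    exact isIrreducible_singleton.closure
  exact { isPreirreducible_univ := h.isPreirreducible, toNonempty := ⟨x⟩ }

instance : IsIntegral Gr := isIntegral_of_irreducibleSpace_of_isReduced Gr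

end Integrality

/-! ### The centre of the projection misses the Plücker variety -/

section Centre

open MvPolynomial

theorem mem_of_forall_X_mem {σ R : Type} [CommRing R] (f : MvPolynomial σ ℂ →+* R) (J : Ideal R)
    (hJ : ∀ k, f (X k) ∈ J) {c : MvPolynomial σ ℂ} {d : ℕ} (hc : c.IsHomogeneous d) (hd : d ≠ 0) :
    f c ∈ J := by
  have h : c ∈ Ideal.span (X '' (Set.univ : Set σ)) := by
    rw [mem_ideal_span_X_image]
    intro m hm
    by_contra! h0
    have hm0 : m = 0 := Finsupp.ext fun i => h0 i (Set.mem_univ i)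
    have := hc (mem_support_iff.mp hm)
    rw [hm0, map_zero] at this
    exact hd this.symm
  have hle : Ideal.span (X '' (Set.univ : Set σ)) ≤ J.comap f := by
    rw [Ideal.span_le]
    rintro _ ⟨k, -, rfl⟩
    exact hJ k
  exact hle h

/-- The ideal of the Plücker variety and the coefficients of the Jacobian sextic generate an ideal
that is primary to the irrelevant ideal. -/
theorem X_mem_of_pluckerIdeal_le {J : Ideal (MvPolynomial PluckerIndex ℂ)} [J.IsPrime]
    (hI : pluckerIdeal ≤ J) (hJ : ∀ k, linearPullback jacobianMap (X k) ∈ J) (p : PluckerIndex) :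
    X p ∈ J := by
  -- The exponent 3 exceeds every basis degree, so all coefficients of X_p³ have positive degree and
  -- lie in the ideal of the sextic coefficients.
  obtain ⟨c, hc, -, h⟩ := exists_sub_mem_pluckerIdeal (isHomogeneous_X_pow (R := ℂ) p 3)
  have hdeg : ∀ i, basisDegree i < 3 := by decide
  have hsum : ∑ i, linearPullback jacobianMap (c i) * moduleBasis i ∈ J := by
    refine sum_mem fun i _ => J.mul_mem_right _ ?_
    exact mem_of_forall_X_mem (linearPullback jacobianMap).toRingHom J hJ (hc i (hdeg i).le)
      (Nat.sub_ne_zero_of_lt (hdeg i))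
  have := add_mem (hI h) hsum
  rw [sub_add_cancel] at this
  exact Ideal.IsPrime.mem_of_pow_mem inferInstance 3 this

theorem disjoint_pluckerVariety_centre :
    Disjoint (pluckerVariety : Set (ProjSpace PluckerIndex)) (centre jacobianMap) := by
  refine Set.disjoint_left.mpr fun x hx hc => ?_
  obtain ⟨p, hp⟩ := exists_X_notMem x
  have : x.asHomogeneousIdeal.toIdeal.IsPrime := x.isPrime
  refine hp (X_mem_of_pluckerIdeal_le (mem_pluckerVariety_iff.mp hx) (fun k => ?_) p)
  rw [linearPullback_X]
  exact hc ⟨k, rfl⟩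

end Centre

/-! ### Closed points of the Grassmannian are pencils -/

section ClosedPoints

open MvPolynomial

theorem isClosed_singleton_iff_pluckerEmbedding {x : Gr} :
    IsClosed ({x} : Set Gr) ↔ IsClosed ({pluckerEmbedding x} : Set (ProjSpace PluckerIndex)) := by
  rw [← Set.image_singleton]
  exact pluckerEmbedding.isClosedEmbedding.isClosed_iff_image_isClosed

theorem exists_pluckerEmbedding_eq_point {a b : Fin 5 → ℂ} (h : wedge a b ≠ 0) :
    ∃ x : Gr, pluckerEmbedding x = point (wedge a b) h := by
  have : point (wedge a b) h ∈ Set.range pluckerEmbedding := by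
    rw [range_pluckerEmbedding, coe_pluckerVariety]
    exact subset_closure (point_wedge_mem_pluckerPoints h)
  exact this

theorem isClosed_of_pluckerEmbedding_eq_point {x : Gr} {v : PluckerIndex → ℂ} {hv : v ≠ 0}
    (h : pluckerEmbedding x = point v hv) : IsClosed ({x} : Set Gr) := by
  rw [isClosed_singleton_iff_pluckerEmbedding, h]
  exact isClosed_point v hv

/-- A closed point has a coordinate vector, which is a zero of `pluckerIdeal` and hence
decomposable. -/
theorem exists_wedge_of_isClosed {x : Gr} (hx : IsClosed ({x} : Set Gr)) :
    ∃ (a b : Fin 5 → ℂ) (h : wedge a b ≠ 0), pluckerEmbedding x = point (wedge a b) h := by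
  obtain ⟨v, hv, h⟩ := exists_eq_point_of_isClosed
    (isClosed_singleton_iff_pluckerEmbedding.mp hx)
  have hmem : pluckerEmbedding x ∈ pluckerVariety := by
    have : pluckerEmbedding x ∈ (pluckerVariety : Set (ProjSpace PluckerIndex)) :=
      range_pluckerEmbedding ▸ Set.mem_range_self x
    exact this
  have hle := mem_pluckerVariety_iff.mp hmem
  rw [h] at hle
  obtain ⟨a, b, rfl⟩ := exists_eq_wedge fun F hF => eval_eq_zero_of_mem_point (hle hF)
  exact ⟨a, b, hv, h⟩

theorem point_plucker_eq_point_plucker_iff {W W' : Pencil} {f g f' g' : MvPolynomial (Fin 2) ℂ}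
    (h : W.1 = Submodule.span ℂ {f, g}) (h' : W'.1 = Submodule.span ℂ {f', g'}) :
    point (plucker f g) (Pencil.plucker_ne_zero h) =
      point (plucker f' g') (Pencil.plucker_ne_zero h') ↔ W = W' := by
  rw [point_eq_point_iff]
  constructor
  · rintro ⟨c, hc⟩
    exact Pencil.eq_of_plucker_eq_smul h h' hc
  · rintro rfl
    exact Pencil.exists_plucker_eq_smul h h'

theorem exists_represents (W : Pencil) : ∃ x : {x : Gr // IsClosed ({x} : Set Gr)},
    ∀ f g : MvPolynomial (Fin 2) ℂ, W.1 = Submodule.span ℂ {f, g} → Represents x.1 f g := by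
  obtain ⟨f, g, -, -, -, h⟩ := W.exists_eq_span
  obtain ⟨x, hx⟩ := exists_pluckerEmbedding_eq_point (Pencil.plucker_ne_zero h)
  refine ⟨⟨x, isClosed_of_pluckerEmbedding_eq_point hx⟩, fun f' g' h' =>
    ⟨Pencil.plucker_ne_zero h', hx.trans ?_⟩⟩
  exact (point_plucker_eq_point_plucker_iff h h').mpr rfl

theorem exists_equiv_closedPoints : ∃ e : Pencil ≃ {x : Gr // IsClosed ({x} : Set Gr)},
    ∀ (W : Pencil) (f g : MvPolynomial (Fin 2) ℂ),
      W.1 = Submodule.span ℂ {f, g} → Represents (e W).1 f g := by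
  choose e he using exists_represents
  refine ⟨Equiv.ofBijective e ⟨fun W W' hWW => ?_, fun ⟨x, hx⟩ => ?_⟩, he⟩
  · obtain ⟨f, g, -, -, -, h⟩ := W.exists_eq_span
    obtain ⟨f', g', -, -, -, h'⟩ := W'.exists_eq_span
    obtain ⟨_, h1⟩ := he W f g h
    obtain ⟨_, h2⟩ := he W' f' g' h'
    rw [hWW] at h1
    exact (point_plucker_eq_point_plucker_iff h h').mp (h1.symm.trans h2)
  · obtain ⟨a, b, h, hab⟩ := exists_wedge_of_isClosed hx
    obtain ⟨h0, h1⟩ := he (Pencil.ofWedge a b h) (quartic a) (quartic b) rfl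
    refine ⟨Pencil.ofWedge a b h, Subtype.ext (pluckerEmbedding.isClosedEmbedding.injective
      (h1.trans (Eq.trans ?_ hab.symm)))⟩
    simp only [plucker_eq_wedge, quarticCoord_quartic]

end ClosedPoints

/-! ### The Jacobian map -/

section JacobianMap

open MvPolynomial

theorem range_pluckerEmbedding_subset :
    Set.range pluckerEmbedding ⊆ Set.range (offCentre jacobianMap).ι := by
  rw [Scheme.Opens.range_ι, range_pluckerEmbedding]
  exact fun x hx => Set.disjoint_left.mp disjoint_pluckerVariety_centre hx

/-- The Plücker embedding, as a morphism to the complement of the centre of `jacobianMap`. -/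
def pluckerOffCentre : Gr ⟶ (offCentre jacobianMap).toScheme :=
  IsOpenImmersion.lift (offCentre jacobianMap).ι pluckerEmbedding range_pluckerEmbedding_subset

theorem pluckerOffCentre_ι : pluckerOffCentre ≫ (offCentre jacobianMap).ι = pluckerEmbedding :=
  IsOpenImmersion.lift_fac _ _ _

theorem pluckerOffCentre_ι_assoc {Z : Scheme} (h : ProjSpace PluckerIndex ⟶ Z) :
    pluckerOffCentre ≫ (offCentre jacobianMap).ι ≫ h = pluckerEmbedding ≫ h := by
  rw [← Category.assoc, pluckerOffCentre_ι]

instance : IsClosedImmersion pluckerOffCentre := by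
  have : IsClosedImmersion (pluckerOffCentre ≫ (offCentre jacobianMap).ι) := by
    rw [pluckerOffCentre_ι]
    infer_instance
  exact IsClosedImmersion.of_comp _ (offCentre jacobianMap).ι

/-- The morphism that sends a pencil of binary quartics to its Jacobian sextic. -/
def jac : Gr ⟶ ProjSpace (Fin 7) := pluckerOffCentre ≫ linearProjection jacobianMap

theorem jac_over : jac ≫ projSpaceOver (Fin 7) = pluckerEmbedding ≫ projSpaceOver PluckerIndex := by
  rw [jac, Category.assoc, linearProjection_over, pluckerOffCentre_ι_assoc]

theorem ι_pluckerOffCentre_apply (x : Gr) :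
    (offCentre jacobianMap).ι (pluckerOffCentre x) = pluckerEmbedding x := by
  rw [← Scheme.Hom.comp_apply, pluckerOffCentre_ι]

theorem jac_apply_of_eq_point {x : Gr} {v : PluckerIndex → ℂ} {hv : v ≠ 0}
    (hx : pluckerEmbedding x = point v hv) :
    ∃ h : jacobianMap v ≠ 0, jac x = point (jacobianMap v) h := by
  rw [jac, Scheme.Hom.comp_apply]
  exact (isLinearProjection_linearProjection jacobianMap).2 _ v hv
    ((ι_pluckerOffCentre_apply x).trans hx)

theorem isJacobianMap_jac : IsJacobianMap jac := by
  refine ⟨jac_over, fun W f g h x ⟨hp, hx⟩ => ?_⟩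
  obtain ⟨hf, hg⟩ := Pencil.isHomogeneous_of_eq_span h
  rw [formCoeff_jacobian hf hg]
  exact jac_apply_of_eq_point hx

/-- Both maps are morphisms over ℂ from a reduced scheme of finite type to a separated one, so
agreement on closed points, which are pencils, is enough. -/
theorem eq_jac_of_isJacobianMap {J : Gr ⟶ ProjSpace (Fin 7)} (hJ : IsJacobianMap J) : J = jac := by
  have : LocallyOfFiniteType (J ≫ projSpaceOver (Fin 7)) := by
    rw [hJ.1]
    infer_instance
  refine ext_of_apply_eq (projSpaceOver (Fin 7)) Set.univ isClosed_univ.isLocallyClosed dense_univ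
    (fun x _ hx => ?_) (hJ.1.trans jac_over.symm)
  obtain ⟨a, b, h, hab⟩ := exists_wedge_of_isClosed hx
  have hr : Represents x (quartic a) (quartic b) := by
    have hp : plucker (quartic a) (quartic b) = wedge a b := by
      rw [plucker_eq_wedge, quarticCoord_quartic, quarticCoord_quartic]
    refine ⟨by rwa [hp], hab.trans ?_⟩
    simp only [hp]
  obtain ⟨_, h1⟩ := hJ.2 (Pencil.ofWedge a b h) _ _ rfl x hr
  obtain ⟨_, h2⟩ := isJacobianMap_jac.2 (Pencil.ofWedge a b h) _ _ rfl x hr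
  exact h1.trans h2.symm

/-- Properness cancels from that of the Grassmannian over ℂ; affineness holds because the map is a
closed immersion followed by an affine projection. -/
instance isFinite_jac : IsFinite jac := by
  rw [IsFinite.iff_isProper_and_isAffineHom]
  constructor
  · have : IsProper (jac ≫ projSpaceOver (Fin 7)) := by
      rw [jac_over]
      infer_instance
    exact IsProper.of_comp jac (projSpaceOver (Fin 7))
  · unfold jac
    infer_instance

/-- The open set of sextics over which the fibre of `jac` has five points. -/
def generalSextics : (ProjSpace (Fin 7)).Opens :=
  Proj.basicOpen (homogeneousSubmodule (Fin 7) ℂ) branchForm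

theorem generalSextics_nonempty : (generalSextics : Set (ProjSpace (Fin 7))).Nonempty := by
  obtain ⟨w, hw⟩ := exists_eval_branchForm_ne_zero
  have hw0 : w ≠ 0 := by
    rintro rfl
    rw [eval_branchForm] at hw
    simp [branch] at hw
  exact ⟨point w hw0, fun h => hw (eval_eq_zero_of_mem_point h)⟩

/-- The fibre of a finite morphism over a closed point is closed and discrete. -/
theorem isClosed_of_isClosed_jac {x : Gr} (h : IsClosed ({jac x} : Set (ProjSpace (Fin 7)))) :
    IsClosed ({x} : Set Gr) := by
  have hd := (jac.isDiscrete_preimage_singleton (jac x)).to_subtype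
  have hc : IsClosed (jac ⁻¹' {jac x}) := h.preimage jac.continuous
  have := (hc.isClosedEmbedding_subtypeVal.isClosedMap {⟨x, rfl⟩} (isClosed_discrete _))
  rwa [Set.image_singleton] at this

theorem ncard_fibre {y : ProjSpace (Fin 7)} (hy : y ∈ generalSextics)
    (hc : IsClosed ({y} : Set (ProjSpace (Fin 7)))) : {x : Gr | jac x = y}.ncard = 5 := by
  obtain ⟨w, hw, hle, hev⟩ := exists_point_of_notMem y hy
  have hyw : y = point w hw := by
    have := mem_closure_iff_ideal_le.mpr hle
    rw [hc.closure_eq] at this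
    exact (Set.mem_singleton_iff.mp this).symm
  rw [eval_branchForm] at hev
  set z : Fin 7 → ℂ := fun i => (sexticFactor i)⁻¹ * w i with hz
  have hz0 : z ≠ 0 := by
    intro h
    rw [h] at hev
    simp [branch] at hev
  have hsol : ∀ v ∈ solutions z, v ≠ 0 := by
    rintro v ⟨-, hv⟩ rfl
    refine hz0 (hv.symm.trans ?_)
    funext i
    fin_cases i <;> simp [sextic]
  have hex : ∀ v ∈ solutions z, ∃ x : Gr, ∃ h : v ≠ 0, pluckerEmbedding x = point v h := by
    intro v hv
    have h0 := hsol v hv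
    obtain ⟨⟨a, b, rfl⟩, -⟩ := hv
    obtain ⟨x, hx⟩ := exists_pluckerEmbedding_eq_point h0
    exact ⟨x, h0, hx⟩
  choose e he0 he using hex
  have hmap : ∀ {v}, v ∈ solutions z → jacobianMap v = w := fun hv =>
    jacobianMap_eq_iff.mpr hv.2
  rw [← ncard_solutions hev]
  -- Each point of the fibre has exactly one Plücker vector whose Jacobian is w itself, not just a
  -- multiple of w, so points of the fibre correspond to `solutions z`.
  refine (Set.ncard_congr e (fun v hv => ?_) (fun v v' hv hv' h => ?_) fun x hx => ?_).symm
  · obtain ⟨h1, h2⟩ := jac_apply_of_eq_point (he v hv)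
    simp only [hmap hv] at h2
    exact h2.trans hyw.symm
  -- Proportional vectors with the same nonzero Jacobian are equal, because the factor c satisfies c
  -- w = w.
  · have h1 := (he v hv).symm.trans ((congrArg pluckerEmbedding h).trans (he v' hv'))
    obtain ⟨c, rfl⟩ := point_eq_point_iff.mp h1
    have h2 := hmap hv'
    rw [map_smul, hmap hv] at h2
    obtain ⟨i, hi⟩ := Function.ne_iff.mp hw
    have h3 := congrFun h2 i
    rw [Pi.smul_apply, smul_eq_mul] at h3
    rw [(mul_eq_right₀ hi).mp h3, one_smul]
  · have hx : jac x = y := hx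
    obtain ⟨a, b, h, hab⟩ := exists_wedge_of_isClosed
      (isClosed_of_isClosed_jac (x := x) (by rwa [hx]))
    obtain ⟨h1, h2⟩ := jac_apply_of_eq_point hab
    obtain ⟨c, hcw⟩ := point_eq_point_iff.mp (h2.symm.trans (hx.trans hyw))
    have hc0 : c • wedge a b ≠ 0 := by
      intro h0
      rw [← map_smul, h0, map_zero] at hcw
      exact hw hcw
    have hmem : c • wedge a b ∈ solutions z := by
      refine ⟨⟨c • a, b, ?_⟩, ?_⟩
      · funext p
        simp only [wedge, Pi.smul_apply, smul_eq_mul]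
        ring
      · rw [hz, ← jacobianMap_eq_iff, map_smul, hcw]
    refine ⟨_, hmem, pluckerEmbedding.isClosedEmbedding.injective ?_⟩
    rw [he _ hmem, point_smul _ h, hab]

instance jacobsonSpace_projSpace : JacobsonSpace (ProjSpace (Fin 7)) :=
  LocallyOfFiniteType.jacobsonSpace (projSpaceOver (Fin 7))

/-- The image is closed and contains the closed points of the dense open set `generalSextics`; these
are dense in it because the space is Jacobson. -/
instance surjective_jac : AlgebraicGeometry.Surjective jac := by
  have hcl : IsClosed (Set.range jac) := jac.isClosedMap.isClosed_range
  have hV : (generalSextics : Set (ProjSpace (Fin 7))) ⊆ Set.range jac := by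
    have h := JacobsonSpace.closure_inter_closedPoints_eq_closure
      generalSextics.isOpen.isLocallyClosed
    refine subset_closure.trans (h ▸ closure_minimal ?_ hcl)
    rintro y ⟨hy, hc⟩
    have := ncard_fibre hy hc
    obtain ⟨x, hx⟩ := Set.nonempty_of_ncard_ne_zero (this.trans_ne (by decide))
    exact ⟨x, hx⟩
  have hd : Dense (generalSextics : Set (ProjSpace (Fin 7))) :=
    generalSextics.isOpen.dense generalSextics_nonempty
  refine ⟨Set.range_eq_univ.mp (Set.eq_univ_of_univ_subset ?_)⟩
  rw [← hd.closure_eq]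
  exact closure_minimal hV hcl

end JacobianMap

/-! ### Degrees of morphisms in affine charts -/

section ResidueDegree

variable {X Y Z : Scheme.{0}}

theorem residueDegree_comp_of_isOpenImmersion_left (c : X ⟶ Y) [IsOpenImmersion c] (f : Y ⟶ Z)
    (x : X) : (c ≫ f).residueDegree x = f.residueDegree (c x) := by
  let r : Z.residueField (f (c x)) ≃+* Z.residueField ((c ≫ f) x) := RingEquiv.refl _
  let i := (asIso (c.residueFieldMap x)).commRingCatIsoToRingEquiv
  let := (f.residueFieldMap (c x)).hom.toAlgebra
  let : Algebra (Z.residueField ((c ≫ f) x)) (X.residueField x) :=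
    ((c ≫ f).residueFieldMap x).hom.toAlgebra
  refine (Algebra.finrank_eq_of_equiv_equiv r i ?_).symm
  have h := Scheme.residueFieldMap_comp c f x
  exact congrArg CommRingCat.Hom.hom h

theorem residueDegree_comp_of_isOpenImmersion_right (f : X ⟶ Y) (t : Y ⟶ Z) [IsOpenImmersion t]
    (x : X) : (f ≫ t).residueDegree x = f.residueDegree x := by
  let i : Z.residueField ((f ≫ t) x) ≃+* Y.residueField (f x) :=
    (asIso (t.residueFieldMap (f x))).commRingCatIsoToRingEquiv
  let := (f.residueFieldMap x).hom.toAlgebra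
  let : Algebra (Z.residueField ((f ≫ t) x)) (X.residueField x) :=
    ((f ≫ t).residueFieldMap x).hom.toAlgebra
  refine Algebra.finrank_eq_of_equiv_equiv i (RingEquiv.refl (X.residueField x)) ?_
  have h := Scheme.residueFieldMap_comp f t x
  exact (congrArg CommRingCat.Hom.hom h).symm

/-- The map from a ring to the residue field of a point of its spectrum. -/
def toResidueField (R : CommRingCat.{0}) (x : Spec R) : R ⟶ (Spec R).residueField x :=
  (Scheme.ΓSpecIso R).inv ≫ (Spec R).Γevaluation x

theorem toResidueField_naturality {R S : CommRingCat.{0}} (f : R ⟶ S) (x : Spec S) :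
    toResidueField R (Spec.map f x) ≫ (Spec.map f).residueFieldMap x = f ≫ toResidueField S x := by
  rw [toResidueField, toResidueField, Category.assoc, Scheme.Γevaluation_naturality,
    ← Category.assoc, ← Category.assoc, Scheme.ΓSpecIso_inv_naturality]

theorem isFractionRing_residueField {R : CommRingCat.{0}} [IsDomain R] {x : Spec R}
    (hx : x.asIdeal = ⊥) :
    letI := (toResidueField R x).hom.toAlgebra
    IsFractionRing R ((Spec R).residueField x) := by
  let := (toResidueField R x).hom.toAlgebra
  have : x.asIdeal.IsPrime := x.isPrime
  have hfr : IsFractionRing R x.asIdeal.ResidueField := by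
    obtain ⟨I, hI⟩ := x
    obtain rfl : I = ⊥ := hx
    exact inferInstanceAs (IsFractionRing R (⊥ : Ideal R).ResidueField)
  have h := Scheme.Spec.algebraMap_residueFieldIso_inv R x
  refine IsLocalization.isLocalization_of_algEquiv (nonZeroDivisors R)
    (AlgEquiv.ofRingEquiv (f := (Scheme.Spec.residueFieldIso R x).symm.commRingCatIsoToRingEquiv)
      fun r => ?_ : x.asIdeal.ResidueField ≃ₐ[R] (Spec R).residueField x)
  exact DFunLike.congr_fun (congrArg CommRingCat.Hom.hom h) r

/-- At the zero ideals the residue fields are the fraction fields, and passing to fraction fields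
preserves the rank. -/
theorem residueDegree_SpecMap {R S : CommRingCat.{0}} [IsDomain R] [IsDomain S] (f : R ⟶ S)
    {x : Spec S} (hx : x.asIdeal = ⊥) (hfx : (Spec.map f x).asIdeal = ⊥) :
    letI := f.hom.toAlgebra
    (Spec.map f).residueDegree x = Module.finrank R S := by
  let := f.hom.toAlgebra
  let := (toResidueField S x).hom.toAlgebra
  let := (toResidueField R (Spec.map f x)).hom.toAlgebra
  let := ((Spec.map f).residueFieldMap x).hom.toAlgebra
  let := (f ≫ toResidueField S x).hom.toAlgebra
  have := isFractionRing_residueField hx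
  have := isFractionRing_residueField hfx
  have : IsScalarTower R ((Spec R).residueField (Spec.map f x)) ((Spec S).residueField x) :=
    IsScalarTower.of_algebraMap_eq' (congrArg CommRingCat.Hom.hom
      (toResidueField_naturality f x).symm)
  have : IsScalarTower R S ((Spec S).residueField x) := IsScalarTower.of_algebraMap_eq' rfl
  exact IsFractionRing.finrank_eq R _ S _

theorem isGenericPoint_of_isOpenImmersion [IrreducibleSpace Y] (c : X ⟶ Y) [IsOpenImmersion c]
    {x : X} (hx : IsGenericPoint x Set.univ) : IsGenericPoint (c x) Set.univ := by
  have h1 : Set.range c ⊆ closure {c x} := by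
    rw [← Set.image_univ, ← hx.def, ← Set.image_singleton]
    exact image_closure_subset_closure_image c.continuous
  have h2 : Dense (Set.range c) :=
    c.isOpenEmbedding.isOpen_range.dense ⟨c x, x, rfl⟩
  refine Set.eq_univ_of_univ_subset ?_
  rw [← h2.closure_eq]
  exact closure_minimal h1 isClosed_closure

/-- A morphism that in affine charts is given by a finite free extension of domains of rank `n` has
degree `n`. -/
theorem exists_residueDegree_eq [IsIntegral X] [IsIntegral Y] (f : X ⟶ Y) {R S : CommRingCat.{0}}
    (c : Spec S ⟶ X) [IsOpenImmersion c] (t : Spec R ⟶ Y) [IsOpenImmersion t] [Nontrivial S]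
    (g : R ⟶ S) (h : c ≫ f = Spec.map g ≫ t) (hg : Function.Injective g) :
    letI := g.hom.toAlgebra
    ∃ x : X, IsGenericPoint x Set.univ ∧ f.residueDegree x = Module.finrank R S := by
  have : Nontrivial R := g.hom.domain_nontrivial
  have : IsIntegral (Spec S) := isIntegral_of_isOpenImmersion c
  have : IsIntegral (Spec R) := isIntegral_of_isOpenImmersion t
  have : IsDomain S := (affine_isIntegral_iff S).mp inferInstance
  have : IsDomain R := (affine_isIntegral_iff R).mp inferInstance
  let x : Spec S := (⟨⊥, Ideal.isPrime_bot⟩ : PrimeSpectrum S)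
  have hx : IsGenericPoint x Set.univ := by
    refine Set.eq_univ_of_forall fun y => ?_
    exact (PrimeSpectrum.le_iff_mem_closure (R := S) x y).mp (bot_le (a := y.asIdeal))
  refine ⟨c x, isGenericPoint_of_isOpenImmersion c hx, ?_⟩
  rw [← residueDegree_comp_of_isOpenImmersion_left, h,
    residueDegree_comp_of_isOpenImmersion_right]
  refine residueDegree_SpecMap g rfl ?_
  exact (RingHom.ker_eq_comap_bot g.hom).symm.trans ((RingHom.injective_iff_ker_eq_bot _).mp hg)

/-- A closed immersion, restricted to an affine open subscheme of the target. -/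
theorem exists_affine_chart (i : X ⟶ Y) [IsClosedImmersion i] {R : CommRingCat.{0}}
    (j : Spec R ⟶ Y) [IsOpenImmersion j] :
    ∃ (S : CommRingCat.{0}) (π : R ⟶ S) (c : Spec S ⟶ X), IsOpenImmersion c ∧
      c ≫ i = Spec.map π ≫ j ∧ Function.Surjective π ∧
      ∀ z : Spec R, j z ∈ Set.range i → z ∈ Set.range (Spec.map π) := by
  -- The base change of i is a closed immersion into an affine scheme, hence the spectrum of a
  -- quotient of R.
  let s := Limits.pullback.snd i j
  obtain ⟨hP, hs⟩ := IsClosedImmersion.isAffine_surjective_of_isAffine s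
  have hπ : Spec.map ((Scheme.ΓSpecIso R).inv ≫ s.appTop) =
      (Limits.pullback i j).isoSpec.inv ≫ s := by
    rw [Spec.map_comp, ← Scheme.isoSpec_Spec_inv, Scheme.isoSpec_inv_naturality]
  refine ⟨_, (Scheme.ΓSpecIso R).inv ≫ s.appTop,
    (Limits.pullback i j).isoSpec.inv ≫ Limits.pullback.fst i j, inferInstance, ?_, ?_, ?_⟩
  · rw [hπ, Category.assoc, Category.assoc, Limits.pullback.condition]
  · exact hs.comp (Scheme.ΓSpecIso R).symm.commRingCatIsoToRingEquiv.surjective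
  · rintro z ⟨x, hx⟩
    obtain ⟨w, -, hw⟩ := Scheme.Pullback.exists_preimage_pullback (f := i) (g := j) x z hx
    rw [hπ]
    refine ⟨(Limits.pullback i j).isoSpec.hom w, ?_⟩
    rw [← Scheme.Hom.comp_apply, Iso.hom_inv_id_assoc]
    exact hw

end ResidueDegree

/-! ### The chart of the Grassmannian over an affine chart of the space of sextics -/

section Chart

open MvPolynomial HomogeneousLocalization

/-- The first coefficient of the Jacobian sextic. -/
abbrev leadingForm : MvPolynomial PluckerIndex ℂ := linearPullback jacobianMap (X 0)

/-- The functions on the chart of the space of Plücker vectors on which `leadingForm` is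
invertible. -/
abbrev PluckerChart : Type := Away (homogeneousSubmodule PluckerIndex ℂ) leadingForm

/-- The functions on the chart of the space of sextics on which the first coefficient is
invertible. -/
abbrev SexticChart : Type := Away (homogeneousSubmodule (Fin 7) ℂ) (X 0 : MvPolynomial (Fin 7) ℂ)

/-- The pullback of functions along the linear projection. -/
abbrev chartPullback : SexticChart →+* PluckerChart := Away.map (linearPullback jacobianMap) (X 0)

theorem leadingForm_mem : leadingForm ∈ homogeneousSubmodule PluckerIndex ℂ 1 :=
  linearPullback_X_mem jacobianMap 0

theorem leadingForm_eq : leadingForm = C 16 * X (idx 0 1) := by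
  refine MvPolynomial.funext fun v => ?_
  rw [eval_linearPullback, eval_X, map_mul, eval_C, eval_X]
  rfl

theorem leadingForm_notMem : leadingForm ∉ pluckerIdeal := by
  rw [leadingForm_eq]
  intro h
  refine (isPrime_pluckerIdeal.mem_or_mem h).elim (fun h => ?_) (X_notMem_pluckerIdeal _)
  simpa using mem_pluckerIdeal_iff.mp h 0 0

theorem leadingForm_ne_zero : leadingForm ≠ 0 := fun h => leadingForm_notMem (h ▸ zero_mem _)

/-- The quotient `F / leadingForm ^ n`. -/
def pluckerFraction (n : ℕ) (F : MvPolynomial PluckerIndex ℂ) (hF : F.IsHomogeneous n) :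
    PluckerChart :=
  Away.mk _ leadingForm_mem n F (by simpa using hF)

theorem exists_eq_pluckerFraction (r : PluckerChart) : ∃ n F hF, r = pluckerFraction n F hF := by
  obtain ⟨n, F, hF, rfl⟩ := Away.mk_surjective _ leadingForm_mem r
  exact ⟨n, F, by simpa using hF, rfl⟩

/-- The quotient `c / X 0 ^ n`. -/
def sexticFraction (n : ℕ) (c : MvPolynomial (Fin 7) ℂ) (hc : c.IsHomogeneous n) :
    SexticChart :=
  Away.mk _ (X_mem_homogeneousSubmodule 0) n c (by simpa using hc)

theorem exists_eq_sexticFraction (r : SexticChart) : ∃ n F hF, r = sexticFraction n F hF := by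
  obtain ⟨n, F, hF, rfl⟩ := Away.mk_surjective _ (X_mem_homogeneousSubmodule 0) r
  exact ⟨n, F, by simpa using hF, rfl⟩

theorem chartPullback_sexticFraction {n : ℕ} {c : MvPolynomial (Fin 7) ℂ} (hc : c.IsHomogeneous n) :
    chartPullback (sexticFraction n c hc) =
      pluckerFraction n (linearPullback jacobianMap c) (linearPullback_isHomogeneous _ hc) :=
  Away.map_mk (linearPullback jacobianMap) (X 0) (X_mem_homogeneousSubmodule 0) n c
    (by simpa using hc)

/-- The inclusion of `PluckerChart` into the localization. -/
def chartVal : PluckerChart →+* Localization.Away leadingForm where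
  toFun := HomogeneousLocalization.val
  map_one' := HomogeneousLocalization.val_one
  map_mul' := HomogeneousLocalization.val_mul
  map_zero' := HomogeneousLocalization.val_zero
  map_add' := HomogeneousLocalization.val_add

theorem chartVal_pluckerFraction {n : ℕ} {F : MvPolynomial PluckerIndex ℂ}
    (hF : F.IsHomogeneous n) :
    chartVal (pluckerFraction n F hF) *
      algebraMap _ (Localization.Away leadingForm) (leadingForm ^ n) = algebraMap _ _ F := by
  have h : chartVal (pluckerFraction n F hF) = Localization.mk F
      (⟨leadingForm ^ n, n, rfl⟩ : Submonoid.powers leadingForm) :=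
    Away.val_mk _ n leadingForm_mem F (by simpa using hF)
  rw [h, Localization.mk_eq_mk']
  exact IsLocalization.mk'_spec (Localization.Away leadingForm) F
    (⟨leadingForm ^ n, n, rfl⟩ : Submonoid.powers leadingForm)

theorem algebraMap_localization_injective :
    Function.Injective (algebraMap (MvPolynomial PluckerIndex ℂ) (Localization.Away leadingForm)) :=
  IsLocalization.injective _ (powers_le_nonZeroDivisors_of_noZeroDivisors leadingForm_ne_zero)

/-- The basis of the functions on the chart of the Grassmannian. -/
def chartBasis (i : Fin 5) : PluckerChart :=
  pluckerFraction (basisDegree i) (moduleBasis i) (moduleBasis_isHomogeneous i)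

/-- Clearing denominators: the extra power of X₀ brings all terms to the common denominator
`leadingForm ^ n`, so that module statements about polynomials apply. -/
theorem chartVal_term {k n : ℕ} {c : MvPolynomial (Fin 7) ℂ} (hc : c.IsHomogeneous k) (i : Fin 5)
    (hn : k + basisDegree i ≤ n) :
    chartVal (chartPullback (sexticFraction k c hc) * chartBasis i) *
        algebraMap _ (Localization.Away leadingForm) (leadingForm ^ n) =
      algebraMap _ _ (linearPullback jacobianMap (c * X 0 ^ (n - (k + basisDegree i))) *
        moduleBasis i) := by
  rw [chartPullback_sexticFraction, map_mul chartVal, ← Nat.sub_add_cancel hn]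
  rw [Nat.add_sub_cancel, pow_add, pow_add, map_mul, map_mul, map_mul, map_mul, map_mul,
    map_pow (linearPullback jacobianMap), ← chartVal_pluckerFraction
    (linearPullback_isHomogeneous _ hc), ← chartVal_pluckerFraction (moduleBasis_isHomogeneous i),
    chartBasis]
  ring

variable {T : Type} [CommRing T] {π : PluckerChart →+* T}

/-- `pluckerIdeal` is prime and does not contain `leadingForm`, so vanishing in the quotient T can
be tested on any numerator. -/
theorem map_eq_zero_iff (hker : ∀ n F hF, π (pluckerFraction n F hF) = 0 ↔ F ∈ pluckerIdeal)
    {r : PluckerChart} {n : ℕ} {F : MvPolynomial PluckerIndex ℂ}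
    (h : chartVal r * algebraMap _ (Localization.Away leadingForm) (leadingForm ^ n) =
      algebraMap _ _ F) : π r = 0 ↔ F ∈ pluckerIdeal := by
  obtain ⟨m, G, hG, rfl⟩ := exists_eq_pluckerFraction r
  have h' : G * leadingForm ^ n = F * leadingForm ^ m := by
    refine algebraMap_localization_injective ?_
    rw [map_mul, map_mul, ← h, ← chartVal_pluckerFraction hG]
    ring
  have hmem : ∀ {H : MvPolynomial PluckerIndex ℂ} {k : ℕ},
      H * leadingForm ^ k ∈ pluckerIdeal ↔ H ∈ pluckerIdeal := fun {H k} =>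
    ⟨fun h => (isPrime_pluckerIdeal.mem_or_mem h).resolve_right fun h =>
      leadingForm_notMem (isPrime_pluckerIdeal.mem_of_pow_mem k h),
      fun h => pluckerIdeal.mul_mem_right _ h⟩
  rw [hker, ← hmem (k := n), h', hmem]

theorem chartBasis_independent
    (hker : ∀ n F hF, π (pluckerFraction n F hF) = 0 ↔ F ∈ pluckerIdeal)
    {a : Fin 5 → SexticChart}
    (ha : ∑ i, π (chartPullback (a i)) * π (chartBasis i) = 0) : a = 0 := by
  choose k c hc hac using fun i => exists_eq_sexticFraction (a i)
  -- A common denominator exponent: the sum of all k, plus the largest basis degree 2.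
  have hle : ∀ i, k i + basisDegree i ≤ (∑ j, k j) + 2 := fun i =>
    add_le_add (Finset.single_le_sum (fun _ _ => Nat.zero_le _) (Finset.mem_univ i))
      (by fin_cases i <;> decide)
  simp only [← map_mul, ← map_sum] at ha
  rw [map_eq_zero_iff hker (n := (∑ j, k j) + 2) (F := ∑ i, linearPullback jacobianMap
    (c i * X 0 ^ ((∑ j, k j) + 2 - (k i + basisDegree i))) * moduleBasis i)] at ha
  · have h0 := eq_zero_of_sum_mem_pluckerIdeal ha
    funext i
    have hi : c i = 0 := (mul_eq_zero.mp (congrFun h0 i)).resolve_right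
      (pow_ne_zero _ (X_ne_zero _))
    rw [hac i]
    have hz : ∀ h, sexticFraction (k i) 0 h = 0 := fun h => by
      refine HomogeneousLocalization.val_injective _ ?_
      rw [sexticFraction, Away.val_mk, Localization.mk_zero, HomogeneousLocalization.val_zero]
    simp only [hi, hz, Pi.zero_apply]
  · rw [map_sum, map_sum, Finset.sum_mul]
    refine Finset.sum_congr rfl fun i _ => ?_
    rw [hac i, chartVal_term (hc i) i (hle i)]

theorem exists_chartBasis_combination
    (hker : ∀ n F hF, π (pluckerFraction n F hF) = 0 ↔ F ∈ pluckerIdeal)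
    (hπ : Function.Surjective π) (t : T) :
    ∃ a : Fin 5 → SexticChart, ∑ i, π (chartPullback (a i)) * π (chartBasis i) = t := by
  obtain ⟨r, rfl⟩ := hπ t
  obtain ⟨n, F, hF, rfl⟩ := exists_eq_pluckerFraction r
  obtain ⟨c, hc, hc0, h⟩ := exists_sub_mem_pluckerIdeal hF
  have hex : ∀ i, ∃ a : SexticChart, chartVal (chartPullback a * chartBasis i) *
      algebraMap _ (Localization.Away leadingForm) (leadingForm ^ n) =
        algebraMap _ _ (linearPullback jacobianMap (c i) * moduleBasis i) := by
    intro i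
    by_cases hi : basisDegree i ≤ n
    · refine ⟨sexticFraction (n - basisDegree i) (c i) (hc i hi), ?_⟩
      rw [chartVal_term (hc i hi) i (Nat.sub_add_cancel hi).le, Nat.sub_add_cancel hi,
        Nat.sub_self, pow_zero, mul_one]
    · refine ⟨0, ?_⟩
      rw [hc0 i (not_le.mp hi), map_zero, map_zero, zero_mul, zero_mul, map_zero, map_zero,
        zero_mul]
  choose a ha using hex
  refine ⟨a, ?_⟩
  have hr : π (pluckerFraction n F hF - ∑ i, chartPullback (a i) * chartBasis i) = 0 := by
    refine (map_eq_zero_iff hker (n := n) ?_).mpr h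
    rw [map_sub, map_sub, sub_mul, chartVal_pluckerFraction, map_sum, map_sum, Finset.sum_mul]
    exact congrArg _ (Finset.sum_congr rfl fun i _ => ha i)
  rw [map_sub, sub_eq_zero, map_sum] at hr
  rw [hr]
  exact Finset.sum_congr rfl fun i _ => (map_mul π _ _).symm

/-- The first basis element is 1, so injectivity is independence applied to combinations supported
there. -/
theorem chartPullback_comp_injective
    (hker : ∀ n F hF, π (pluckerFraction n F hF) = 0 ↔ F ∈ pluckerIdeal) :
    Function.Injective (π.comp chartPullback) := by
  rw [injective_iff_map_eq_zero]
  intro a ha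
  have := chartBasis_independent hker (a := Pi.single 0 a) (by
    refine Finset.sum_eq_zero fun i _ => ?_
    rcases eq_or_ne i 0 with rfl | hi
    · rw [Pi.single_eq_same]
      exact mul_eq_zero_of_left ha _
    · rw [Pi.single_eq_of_ne hi, map_zero, map_zero, zero_mul])
  simpa using congrFun this 0

theorem finrank_chart [Nontrivial T]
    (hker : ∀ n F hF, π (pluckerFraction n F hF) = 0 ↔ F ∈ pluckerIdeal)
    (hπ : Function.Surjective π) :
    letI := (π.comp chartPullback).toAlgebra
    Module.finrank SexticChart T = 5 := by
  let := (π.comp chartPullback).toAlgebra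
  have : Nontrivial SexticChart := (π.comp chartPullback).domain_nontrivial
  have hb : Function.Bijective (Fintype.linearCombination SexticChart fun i => π (chartBasis i)) := by
    constructor
    · rw [← LinearMap.ker_eq_bot, LinearMap.ker_eq_bot']
      intro a ha
      exact chartBasis_independent hker ha
    · intro t
      exact exists_chartBasis_combination hker hπ t
  rw [← (LinearEquiv.ofBijective _ hb).finrank_eq, Module.finrank_fin_fun]

end Chart

/-! ### Degree and ramification of the Jacobian map -/

section Degree

open MvPolynomial

/-- Raises the degree of the numerator to a positive one, as the criterion `mem_awayι_apply_iff`
requires. -/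
theorem pluckerFraction_eq_succ {n : ℕ} {F : MvPolynomial PluckerIndex ℂ} (hF : F.IsHomogeneous n) :
    pluckerFraction n F hF = pluckerFraction (n + 1) (F * leadingForm)
      (hF.mul leadingForm_mem) := by
  refine HomogeneousLocalization.val_injective _ ?_
  rw [pluckerFraction, pluckerFraction, HomogeneousLocalization.Away.val_mk,
    HomogeneousLocalization.Away.val_mk, Localization.mk_eq_mk_iff, Localization.r_iff_exists]
  exact ⟨1, by simp only [pow_succ]; ring⟩

theorem exists_sourceChart_eq_genericPointPlucker :
    ∃ z, sourceChart jacobianMap 0 z = genericPointPlucker := by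
  refine (mem_range_sourceChart jacobianMap 0 genericPointPlucker).mpr ?_
  rw [← linearPullback_X]
  exact leadingForm_notMem

/-- The chart is affine but its ring T is abstract; all that is used later is that T is a quotient
of `PluckerChart` whose kernel consists of the fractions with numerator in `pluckerIdeal`. -/
theorem exists_chart : ∃ (T : CommRingCat.{0}) (π : CommRingCat.of PluckerChart ⟶ T)
    (c : Spec T ⟶ Gr), IsOpenImmersion c ∧ Nontrivial T ∧ Function.Surjective π.hom ∧
      (∀ n F hF, π.hom (pluckerFraction n F hF) = 0 ↔ F ∈ pluckerIdeal) ∧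
      c ≫ jac = Spec.map (CommRingCat.ofHom (π.hom.comp chartPullback)) ≫ targetChart 0 := by
  obtain ⟨T, π, c, hc, hcomm, hπ, hrange⟩ :=
    exists_affine_chart pluckerEmbedding (sourceChart jacobianMap 0)
  obtain ⟨z, hz⟩ := exists_sourceChart_eq_genericPointPlucker
  obtain ⟨w, rfl⟩ := hrange z (hz ▸ exists_pluckerEmbedding_eq_genericPointPlucker)
  have hT : Nontrivial T := ⟨0, 1, fun h => w.isPrime.ne_top (by
    rw [Ideal.eq_top_iff_one, ← h]
    exact zero_mem _)⟩
  have : IsIntegral (Spec T) := isIntegral_of_isOpenImmersion c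
  have : IsDomain T := (affine_isIntegral_iff T).mp inferInstance
  have hmem : ∀ (w : Spec T) {n : ℕ} {F : MvPolynomial PluckerIndex ℂ} (hF : F.IsHomogeneous n),
      F * leadingForm ∈ (sourceChart jacobianMap 0 (Spec.map π w)).asHomogeneousIdeal ↔
        π.hom (pluckerFraction n F hF) ∈ w.asIdeal := by
    intro w n F hF
    rw [pluckerFraction_eq_succ hF]
    exact mem_awayι_apply_iff leadingForm_mem n.succ_pos (hF.mul leadingForm_mem) (Spec.map π w)
  refine ⟨T, π, c, hc, hT, hπ, fun n F hF => ⟨fun h => ?_, fun h => ?_⟩, ?_⟩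
  -- The point w lies over the generic point of the Plücker variety, whose ideal is exactly
  -- `pluckerIdeal`.
  · have h1 := (hmem w hF).mpr (h ▸ zero_mem _)
    rw [hz] at h1
    have h2 : F * leadingForm ∈ pluckerIdeal := h1
    exact (isPrime_pluckerIdeal.mem_or_mem h2).resolve_right leadingForm_notMem
  -- Conversely, the zero ideal of the domain T is a point of the Plücker variety, so a numerator in
  -- `pluckerIdeal` maps into the zero ideal.
  · let w₀ : Spec T := (⟨⊥, Ideal.isPrime_bot⟩ : PrimeSpectrum T)
    refine Ideal.mem_bot.mp ((hmem w₀ hF).mp ?_)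
    have h1 : sourceChart jacobianMap 0 (Spec.map π w₀) = pluckerEmbedding (c w₀) := by
      rw [← Scheme.Hom.comp_apply, ← Scheme.Hom.comp_apply, hcomm]
    rw [h1]
    have h2 : pluckerEmbedding (c w₀) ∈ pluckerVariety := by
      have : pluckerEmbedding (c w₀) ∈ (pluckerVariety : Set (ProjSpace PluckerIndex)) :=
        range_pluckerEmbedding ▸ Set.mem_range_self _
      exact this
    exact mem_pluckerVariety_iff.mp h2 (pluckerIdeal.mul_mem_right _ h)
  · have h1 : c ≫ pluckerOffCentre = Spec.map π ≫ offCentreChart jacobianMap 0 := by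
      rw [← cancel_mono (offCentre jacobianMap).ι, Category.assoc, Category.assoc,
        pluckerOffCentre_ι, offCentreChart_ι, hcomm]
    rw [jac, ← Category.assoc, h1, Category.assoc, offCentreChart_linearProjection,
      ← Spec.map_comp_assoc]
    rfl

theorem hasMorphismDegree_jac : HasMorphismDegree jac 5 := by
  obtain ⟨T, π, c, hc, hT, hπ, hker, hcomm⟩ := exists_chart
  refine ⟨inferInstance, inferInstance, inferInstance, ?_⟩
  obtain ⟨x, hx, hdeg⟩ := exists_residueDegree_eq jac c (targetChart 0)
    (CommRingCat.ofHom (π.hom.comp chartPullback)) hcomm (chartPullback_comp_injective hker)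
  exact ⟨x, hx, hdeg.trans (finrank_chart hker hπ)⟩

end Degree

/-! ### Ramification at the pencil spanned by t₀⁴ and t₀³t₁ -/

section Ramification

open MvPolynomial

/-- A tangent vector of the Grassmannian at the pencil spanned by `t₀ ^ 4` and `t₀ ^ 3 * t₁`. -/
def tangentVector (t : DualNumber ℂ) : PluckerIndex → DualNumber ℂ :=
  wedge ![1, 0, t, 0, 0] ![0, 1, 0, 2 * t, 0]

/-- Here p₀₃ = 2t and p₁₂ = -t cancel in p₀₃ + 2p₁₂, and p₂₃ = 2t² is zero. So the direction t = ε
lies in the kernel of the differential. -/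
theorem sextic_tangentVector {t : DualNumber ℂ} (ht : t * t = 0) :
    sextic (tangentVector t) = ![1, 0, 0, 0, 0, 0, 0] := by
  have h : t * (2 * t) = 0 := by rw [mul_left_comm, ht, mul_zero]
  funext i
  fin_cases i <;> simp [sextic, tangentVector, wedge, h]

/-- The Jacobian sextic of the pencil spanned by `t₀ ^ 4` and `t₀ ^ 3 * t₁`. -/
def tangentSextic (i : Fin 7) : DualNumber ℂ :=
  algebraMap ℂ (DualNumber ℂ) (sexticFactor i) * (![1, 0, 0, 0, 0, 0, 0] : Fin 7 → DualNumber ℂ) i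

theorem linearPullback_X_eq_sextic (i : Fin 7) :
    linearPullback jacobianMap (X i) = C (sexticFactor i) * sextic (X : PluckerIndex → MvPolynomial PluckerIndex ℂ) i := by
  rw [sextic_X, map_mul, linearPullback_C, ← mul_assoc, ← C_mul,
    mul_inv_cancel₀ (sexticFactor_ne_zero i), C_1, one_mul]

theorem aeval_tangentVector_linearPullback {t : DualNumber ℂ} (ht : t * t = 0)
    (F : MvPolynomial (Fin 7) ℂ) :
    aeval (tangentVector t) (linearPullback jacobianMap F) = aeval tangentSextic F := by
  have h : ((aeval (tangentVector t)).toRingHom.comp (linearPullback jacobianMap).toRingHom) =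
      (aeval tangentSextic).toRingHom := by
    refine MvPolynomial.ringHom_ext (fun r => ?_) fun i => ?_
    · change aeval (tangentVector t) (linearPullback jacobianMap (C r)) = aeval tangentSextic (C r)
      rw [linearPullback_C, aeval_C, aeval_C]
    · change aeval (tangentVector t) (linearPullback jacobianMap (X i)) = aeval tangentSextic (X i)
      have hs : aeval (tangentVector t)
          (sextic (X : PluckerIndex → MvPolynomial PluckerIndex ℂ) i) = sextic (tangentVector t) i := by
        fin_cases i <;> simp [sextic]
      rw [linearPullback_X_eq_sextic, map_mul, aeval_C, aeval_X, hs, sextic_tangentVector ht]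
      rfl
  exact DFunLike.congr_fun h F

theorem aeval_tangentVector_leadingForm (t : DualNumber ℂ) :
    aeval (tangentVector t) leadingForm = algebraMap ℂ (DualNumber ℂ) 16 := by
  rw [leadingForm_eq, map_mul, aeval_C, aeval_X]
  simp [tangentVector, wedge]

theorem isUnit_aeval_tangentVector_leadingForm (t : DualNumber ℂ) :
    IsUnit ((aeval (tangentVector t)).toRingHom leadingForm) := by
  change IsUnit (aeval (tangentVector t) leadingForm)
  rw [aeval_tangentVector_leadingForm]
  exact (IsUnit.mk0 (16 : ℂ) (by norm_num)).map _

/-- Evaluation at a tangent vector, on the chart of the space of Plücker vectors. -/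
def evalChart (t : DualNumber ℂ) : PluckerChart →+* DualNumber ℂ :=
  (IsLocalization.Away.lift leadingForm (isUnit_aeval_tangentVector_leadingForm t)).comp chartVal

theorem evalChart_pluckerFraction (t : DualNumber ℂ) {n : ℕ} {F : MvPolynomial PluckerIndex ℂ}
    (hF : F.IsHomogeneous n) :
    evalChart t (pluckerFraction n F hF) * algebraMap ℂ (DualNumber ℂ) 16 ^ n =
      aeval (tangentVector t) F := by
  have h := congrArg (IsLocalization.Away.lift leadingForm
    (isUnit_aeval_tangentVector_leadingForm t)) (chartVal_pluckerFraction hF)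
  rw [map_mul, IsLocalization.Away.lift_eq, IsLocalization.Away.lift_eq] at h
  rw [← aeval_tangentVector_leadingForm t, ← map_pow]
  exact h

theorem isUnit_algebraMap_pow (n : ℕ) : IsUnit (algebraMap ℂ (DualNumber ℂ) 16 ^ n) :=
  ((IsUnit.mk0 (16 : ℂ) (by norm_num)).map _).pow n

variable {T : Type} [CommRing T] {π : PluckerChart →+* T}

/-- The tangent vector is the wedge of two vectors over the dual numbers, so it satisfies every
relation in `pluckerIdeal` and evaluation descends to T. -/
theorem ker_le_ker_evalChart
    (hker : ∀ n F hF, π (pluckerFraction n F hF) = 0 ↔ F ∈ pluckerIdeal) (t : DualNumber ℂ) :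
    RingHom.ker π ≤ RingHom.ker (evalChart t) := by
  intro r hr
  obtain ⟨n, F, hF, rfl⟩ := exists_eq_pluckerFraction r
  have h := evalChart_pluckerFraction t hF
  rw [tangentVector, aeval_wedge_eq_zero _ _ ((hker n F hF).mp hr)] at h
  exact (isUnit_algebraMap_pow n).mul_left_eq_zero.mp h

/-- The Jacobian map is ramified at the pencil spanned by `t₀ ^ 4` and `t₀ ^ 3 * t₁`. -/
theorem not_formallyUnramified_chart (hπ : Function.Surjective π)
    (hker : ∀ n F hF, π (pluckerFraction n F hF) = 0 ↔ F ∈ pluckerIdeal) :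
    ¬ (π.comp chartPullback).FormallyUnramified := by
  intro hun
  let g (t : DualNumber ℂ) : T →+* DualNumber ℂ :=
    π.liftOfSurjective hπ ⟨evalChart t, ker_le_ker_evalChart hker t⟩
  have hg (t : DualNumber ℂ) (r : PluckerChart) : g t (π r) = evalChart t r :=
    RingHom.liftOfRightInverse_comp_apply _ _ _ _ r
  have hε : (DualNumber.eps : DualNumber ℂ) * DualNumber.eps = 0 := DualNumber.eps_mul_eps
  have hcomm (r : SexticChart) : g DualNumber.eps (π (chartPullback r)) =
      g 0 (π (chartPullback r)) := by
    obtain ⟨n, F, hF, rfl⟩ := exists_eq_sexticFraction r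
    rw [hg, hg, chartPullback_sexticFraction]
    refine (isUnit_algebraMap_pow n).mul_right_cancel ?_
    rw [evalChart_pluckerFraction, evalChart_pluckerFraction,
      aeval_tangentVector_linearPullback hε, aeval_tangentVector_linearPullback (mul_zero 0)]
  let := (π.comp chartPullback).toAlgebra
  let := ((g 0).comp (π.comp chartPullback)).toAlgebra
  have : Algebra.FormallyUnramified SexticChart T := hun
  let g₁ : T →ₐ[SexticChart] DualNumber ℂ := { g DualNumber.eps with commutes' := hcomm }
  let g₂ : T →ₐ[SexticChart] DualNumber ℂ := { g 0 with commutes' := fun _ => rfl }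
  have hfst (w : PluckerIndex → DualNumber ℂ) (F : MvPolynomial PluckerIndex ℂ) :
      TrivSqZeroExt.fstHom ℂ ℂ ℂ (aeval w F) = aeval (fun p => (w p).fst) F := by
    rw [← AlgHom.comp_apply, comp_aeval]
    rfl
  -- Both maps lift the same map to ℂ modulo the square-zero ideal (ε) and agree on the base, so
  -- formal unramifiedness would identify them.
  have heq : g₁ = g₂ := by
    refine Algebra.FormallyUnramified.ext' (TrivSqZeroExt.fstHom ℂ ℂ ℂ).toRingHom
      ⟨2, TrivSqZeroExt.kerIdeal_sq ℂ ℂ⟩ g₁ g₂ fun x => ?_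
    obtain ⟨r, rfl⟩ := hπ x
    obtain ⟨n, F, hF, rfl⟩ := exists_eq_pluckerFraction r
    change TrivSqZeroExt.fstHom ℂ ℂ ℂ (g DualNumber.eps (π _)) =
      TrivSqZeroExt.fstHom ℂ ℂ ℂ (g 0 (π _))
    rw [hg, hg]
    refine ((isUnit_algebraMap_pow n).map (TrivSqZeroExt.fstHom ℂ ℂ ℂ)).mul_right_cancel ?_
    rw [← map_mul, ← map_mul, evalChart_pluckerFraction, evalChart_pluckerFraction, hfst, hfst]
    congr 2
    funext ⟨⟨i, j⟩, hij⟩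
    fin_cases i <;> fin_cases j <;> simp [tangentVector, wedge]
  -- The coordinate p₁₂ = -t tells t = ε from t = 0, the contradiction sought.
  have h12 (t : DualNumber ℂ) : g t (π (pluckerFraction 1 (X (idx 1 2)) (isHomogeneous_X _ _))) *
      algebraMap ℂ (DualNumber ℂ) 16 ^ 1 = -t := by
    rw [hg, evalChart_pluckerFraction, aeval_X]
    simp [tangentVector, wedge]
  have h1 := h12 DualNumber.eps
  have h2 : g DualNumber.eps (π (pluckerFraction 1 (X (idx 1 2)) (isHomogeneous_X _ _))) =
    g 0 (π (pluckerFraction 1 (X (idx 1 2)) (isHomogeneous_X _ _))) := DFunLike.congr_fun heq _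
  rw [h2, h12, neg_zero] at h1
  have h3 := congrArg TrivSqZeroExt.snd h1
  simp at h3

/-- Restriction to an open chart preserves formal unramifiedness, and the chart of the target can be
cancelled, which reduces the claim to rings. -/
theorem not_formallyUnramified_jac : ¬ FormallyUnramified jac := by
  intro h
  obtain ⟨T, π, c, hc, hT, hπ, hker, hcomm⟩ := exists_chart
  have h1 : FormallyUnramified (c ≫ jac) :=
    MorphismProperty.comp_mem @FormallyUnramified _ _ inferInstance h
  rw [hcomm] at h1
  have h2 := FormallyUnramified.of_comp
    (Spec.map (CommRingCat.ofHom (π.hom.comp chartPullback))) (targetChart (0 : Fin 7))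
  rw [HasRingHomProperty.Spec_iff (P := @FormallyUnramified)] at h2
  exact not_formallyUnramified_chart hπ hker h2

end Ramification

end

end JacobianPencil

theorem mainTheorem8 :
    -- the closed points of the Grassmannian are the pencils of binary quartics
    (∃ e : Pencil ≃ {x : Gr // IsClosed ({x} : Set Gr)},
      ∀ (W : Pencil) (f g : MvPolynomial (Fin 2) ℂ),
        W.1 = Submodule.span ℂ {f, g} → Represents (e W).1 f g) ∧
    -- the Jacobian map is a well-defined morphism
    ∃ Jac : Gr ⟶ ProjSpace (Fin 7), IsJacobianMap Jac ∧
      (∀ J : Gr ⟶ ProjSpace (Fin 7), IsJacobianMap J → J = Jac) ∧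
      -- it is a finite ramified covering
      IsFinite Jac ∧ AlgebraicGeometry.Surjective Jac ∧ ¬ FormallyUnramified Jac ∧
      -- its degree is the degree of the Plücker variety, and that is five
      HasProjectiveDegree (pluckerVariety : Set (ProjSpace PluckerIndex)) 6 5 ∧
      HasMorphismDegree Jac 5 ∧
      -- a general fibre consists of five pencils
      (∃ V : (ProjSpace (Fin 7)).Opens, (V : Set (ProjSpace (Fin 7))).Nonempty ∧
        ∀ y ∈ V, IsClosed ({y} : Set (ProjSpace (Fin 7))) → {x : Gr | Jac x = y}.ncard = 5) ∧
      -- it is the Plücker embedding followed by a linear projection of `ℙ⁹` whose centre does not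
      -- meet the Plücker variety
      IsClosedImmersion pluckerEmbedding ∧
      ∃ q : (PluckerIndex → ℂ) →ₗ[ℂ] (Fin 7 → ℂ), Function.Surjective q ∧
        Disjoint (pluckerVariety : Set (ProjSpace PluckerIndex)) (centre q) ∧
        ∃ pr : (offCentre q).toScheme ⟶ ProjSpace (Fin 7), IsLinearProjection q pr ∧
          ∃ p : Gr ⟶ (offCentre q).toScheme,
            p ≫ (offCentre q).ι = pluckerEmbedding ∧ p ≫ pr = Jac := by
  refine ⟨exists_equiv_closedPoints, jac, isJacobianMap_jac, fun J hJ => eq_jac_of_isJacobianMap hJ,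
    isFinite_jac, surjective_jac, not_formallyUnramified_jac, hasProjectiveDegree_pluckerVariety,
    hasMorphismDegree_jac, ⟨generalSextics, generalSextics_nonempty, fun y hy hc =>
      ncard_fibre hy hc⟩, isClosedImmersion_pluckerEmbedding, jacobianMap, jacobianMap_surjective,
    disjoint_pluckerVariety_centre, linearProjection jacobianMap,
    isLinearProjection_linearProjection jacobianMap, pluckerOffCentre, pluckerOffCentre_ι, rfl⟩
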